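/- Let $\mathfrak H$ be a complex separable Hilbert space with inner product $\langle\cdot,\cdot\rangle$ linear in the first argument, let $h\mapsto\bar h$ be a complex conjugation on $\mathfrak H$ (an antilinear isometric involution), and let $Z=\{Z(h):h\in\mathfrak H\}$ be a complex Gaussian isonormal process on a probability space $(\Omega,\mathcal F,P)$, i.e. a centered jointly Gaussian family of complex random variables with $E[Z(h)^2]=0$ and $E[Z(g)\overline{Z(h)}]=\langle g,h\rangle$ for all $g,h\in\mathfrak H$. *Multiple integrals.* Let $J_{m,n}(z,\rho)=\sum_{r=0}^{m\wedge n}(-1)^r r!\binom mr\binom nr z^{m-r}\bar z^{\,n-r}\rho^r$ be the complex Hermite polynomials, and $J_{m,n}(z)=J_{m,n}(z,2)$. Fix an orthonormal basis $(e_k)$ of $\mathfrak H$. For finitely supported multi-indices $\mathbf m,\mathbf n$ put $$\mathbf J_{\mathbf m,\mathbf n}=\prod_k \frac{1}{\sqrt{2^{m_k+n_k}m_k!\,n_k!}}\,J_{m_k,n_k}(\sqrt2\,Z(e_k)).$$ Let $\mathfrak H^{\odot m}\otimes\mathfrak H^{\odot n}\subset\mathfrak H^{\otimes(m+n)}$ be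 the closed subspace of Hilbert space tensors that are symmetric in the first $m$ and in the last $n$ factors. For $f\in\mathfrak H^{\odot m}\otimes\mathfrak H^{\odot n}$ with coefficients $a_{j,l}=\langle f,\,e_{j_1}\otimes\dots\otimes e_{j_m}\otimes\bar e_{l_1}\otimes\dots\otimes\bar e_{l_n}\rangle$, the complex multiple Wiener–Itô integral is $$I_{m,n}(f)=\sum_{j,l}a_{j,l}\,\sqrt{\mathbf m(j)!\,\mathbf n(l)!}\;\mathbf J_{\mathbf m(j),\mathbf n(l)}\quad\text{in }L^2(\Omega),$$ where $\mathbf m(j)$ and $\mathbf n(l)$ count how often each index occurs in $j=(j_1,\dots,j_m)$ and $l=(l_1,\dots,l_n)$. *Operators.* For smooth random variables $F=g(Z(\varphi_1),\dots,Z(\varphi_k))$, with $g:\mathbb C^k\to\mathbb C$ of class $C^\infty$ and all its partial derivatives of polynomial growth, let $DF=\sum_i\frac{\partial g}{\partial z_i}(Z(\varphi_1),\dots,Z(\varphi_k))\,\varphi_i$ and $\bar DF=\sum_i\frac{\partial g}{\partial\bar z_i}(Z(\varphi_1),\dots,Z(\varphi_k))\,\bar\varphi_i$ (Wirtinger derivatives);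 denote by $D$ and $\bar D$ also their closures as operators $L^2(\Omega)\to L^2(\Omega;\mathfrak H)$. The divergences $\delta,\bar\delta$ are their adjoints: $\delta u$ (resp. $\bar\delta u$) is the element of $L^2(\Omega,\sigma(Z),P)$, if it exists, with $E[(\delta u)\overline F]=E[\langle u,DF\rangle]$ (resp. $E[(\bar\delta u)\overline F]=E[\langle u,\bar DF\rangle]$) for all smooth $F$. The complex Ornstein–Uhlenbeck operators are $L=\delta D$ and $\bar L=\bar\delta\bar D$, with their natural domains. **Proposition.** For all $m,n\ge0$ and all $f\in\mathfrak H^{\odot m}\otimes\mathfrak H^{\odot n}$, the series defining $I_{m,n}(f)$ converges unconditionally in $L^2(\Omega)$, the random variable $I_{m,n}(f)$ belongs to the domains of $L$ and $\bar L$, and the values of these operators are determined uniquely on it and are $$L\,I_{m,n}(f)=m\,I_{m,n}(f),\qquad \bar L\,I_{m,n}(f)=n\,I_{m,n}(f).$$ -/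

import Mathlib

open MeasureTheory ProbabilityTheory ComplexConjugate
open scoped ENNReal Nat InnerProductSpace

namespace ComplexWiener

noncomputable section

/-! ### Hilbert space tensor products -/

section Tensor

open scoped ComplexOrder in
theorem inner_posSemidef {𝕜 X E : Type*} [RCLike 𝕜] [NormedAddCommGroup E]
    [InnerProductSpace 𝕜 E] (v : X → E) :
    (Matrix.of fun x y : X => ⟪v x, v y⟫_𝕜).PosSemidef := by
  refine ⟨?_, fun c => ?_⟩
  · ext x y
    simp [Matrix.conjTranspose_apply]
  · have h : (c.sum fun i xi => c.sum fun j xj =>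
        star xi * (Matrix.of fun x y : X => ⟪v x, v y⟫_𝕜) i j * xj)
        = ⟪c.sum fun i xi => xi • v i, c.sum fun i xi => xi • v i⟫_𝕜 := by
      simp only [Finsupp.sum, sum_inner]
      refine Finset.sum_congr rfl fun i _ => ?_
      rw [inner_sum]
      refine Finset.sum_congr rfl fun j _ => ?_
      simp only [Matrix.of_apply, RCLike.star_def, inner_smul_left, inner_smul_right]
      ring
    rw [h, ← inner_self_ofReal_re]
    exact_mod_cast inner_self_nonneg

open scoped ComplexOrder in
/-- The scalar kernel `(x, y) ↦ ∏ᵢ ⟪xᵢ, yᵢ⟫` is positive semidefinite. -/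
theorem prod_inner_posSemidef {𝕜 H : Type*} [RCLike 𝕜] [NormedAddCommGroup H]
    [InnerProductSpace 𝕜 H] {κ : Type*} (s : Finset κ) :
    (Matrix.of fun x y : κ → H => ∏ i ∈ s, ⟪x i, y i⟫_𝕜).PosSemidef := by
  classical
  induction s using Finset.induction_on with
  | empty =>
    have h := inner_posSemidef (𝕜 := 𝕜) (fun _ : κ → H => (1 : 𝕜))
    convert h using 1
    ext x y
    simp
  | insert a s ha ih =>
    have h := (inner_posSemidef (𝕜 := 𝕜) (fun x : κ → H => x a)).hadamard ih
    convert h using 1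
    ext x y
    simp [Finset.prod_insert ha]

variable (κ : Type*) [Fintype κ] (H : Type*) [NormedAddCommGroup H] [InnerProductSpace ℂ H]

/-- The kernel `(x, y) ↦ ∏ᵢ ⟪xᵢ, yᵢ⟫` on `κ → H`, acting on `ℂ` by multiplication. -/
def tensorKernel : Matrix (κ → H) (κ → H) (ℂ →L[ℂ] ℂ) :=
  Matrix.of fun x y => (∏ i, ⟪x i, y i⟫_ℂ) • ContinuousLinearMap.id ℂ ℂ

instance tensorKernel_posSemidef : Fact (tensorKernel κ H).PosSemidef := by
  have h := prod_inner_posSemidef (𝕜 := ℂ) (H := H) (Finset.univ : Finset κ)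
  have key := (RKHS.posSemidef_tfae (K := tensorKernel κ H)).out 0 2
  refine ⟨key.mpr ⟨?_, fun v => ?_⟩⟩
  · ext x y
    have := h.1.apply x y
    simp only [Matrix.of_apply] at this
    have hid : (star (ContinuousLinearMap.id ℂ ℂ)) = ContinuousLinearMap.id ℂ ℂ :=
      star_one (ℂ →L[ℂ] ℂ)
    simp [tensorKernel, Matrix.conjTranspose_apply, hid]
  · have h2 := h.2 v
    have h3 := (RCLike.nonneg_iff.mp h2).1
    simp only [tensorKernel, Finsupp.sum] at h3 ⊢
    convert h3 using 1
    congr 1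
    refine Finset.sum_congr rfl fun i _ => Finset.sum_congr rfl fun j _ => ?_
    simp
    ring

/-- The Hilbert space tensor power `H^{⊗ κ}` (one factor for each element of the finite type `κ`):
the completion of the span of symbols `⊗ᵢ xᵢ` for the inner product
`⟪⊗ᵢ xᵢ, ⊗ᵢ yᵢ⟫ = ∏ᵢ ⟪xᵢ, yᵢ⟫`. -/
abbrev HilbertTensor : Type _ := RKHS.OfKernel (tensorKernel κ H)

variable {κ H}

/-- The elementary tensor `⊗ᵢ xᵢ`, as a multilinear map. -/
def pureTensor : MultilinearMap ℂ (fun _ : κ => H) (HilbertTensor κ H) where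
  toFun x := RKHS.kerFun (HilbertTensor κ H) x (1 : ℂ)
  map_update_add' x i a b := by
    refine RKHS.ext fun y => ?_
    simp only [RKHS.coe_add, Pi.add_apply, RKHS.kerFun_apply, RKHS.OfKernel.kernel_ofKernel]
    have h := ((MultilinearMap.mkPiAlgebra ℂ κ ℂ).compLinearMap
      fun j => innerₛₗ ℂ (y j)).map_update_add x i a b
    simp only [MultilinearMap.compLinearMap_apply, MultilinearMap.mkPiAlgebra_apply,
      innerₛₗ_apply_apply] at h
    simpa [tensorKernel] using h
  map_update_smul' x i c a := by
    refine RKHS.ext fun y => ?_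
    simp only [RKHS.coe_smul, Pi.smul_apply, RKHS.kerFun_apply, RKHS.OfKernel.kernel_ofKernel]
    have h := ((MultilinearMap.mkPiAlgebra ℂ κ ℂ).compLinearMap
      fun j => innerₛₗ ℂ (y j)).map_update_smul x i c a
    simp only [MultilinearMap.compLinearMap_apply, MultilinearMap.mkPiAlgebra_apply,
      innerₛₗ_apply_apply] at h
    simpa [tensorKernel] using h

theorem inner_pureTensor (x y : κ → H) : ⟪pureTensor x, pureTensor y⟫_ℂ = ∏ i, ⟪x i, y i⟫_ℂ := by
  change ⟪RKHS.kerFun (HilbertTensor κ H) x (1 : ℂ), RKHS.kerFun (HilbertTensor κ H) y (1 : ℂ)⟫_ℂ = _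
  rw [RKHS.kerFun_inner, RKHS.kerFun_apply, RKHS.OfKernel.kernel_ofKernel]
  simp [tensorKernel]

theorem span_pureTensor_dense :
    (Submodule.span ℂ (Set.range (pureTensor : (κ → H) → HilbertTensor κ H))).topologicalClosure = ⊤ := by
  rw [← RKHS.kerFun_dense (H := HilbertTensor κ H)]
  congr 1
  refine le_antisymm (Submodule.span_mono ?_) (Submodule.span_le.mpr ?_)
  · rintro _ ⟨x, rfl⟩
    exact ⟨x, 1, rfl⟩
  · rintro _ ⟨x, v, rfl⟩
    have h : RKHS.kerFun (HilbertTensor κ H) x v = v • pureTensor x := by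
      change _ = v • RKHS.kerFun (HilbertTensor κ H) x (1 : ℂ)
      rw [← map_smul, smul_eq_mul, mul_one]
    rw [h]
    exact Submodule.smul_mem _ _ (Submodule.subset_span ⟨x, rfl⟩)

/-- The symmetrization `(x₁ ⊙ … ⊙ x_m) ⊗ (y₁ ⊙ … ⊙ y_n)` of
`x₁ ⊗ … ⊗ x_m ⊗ y₁ ⊗ … ⊗ y_n`, separately in the first `m` and in the last `n` factors. -/
def symmetrizedTensor {m n : ℕ} (x : Fin m → H) (y : Fin n → H) :
    HilbertTensor (Fin m ⊕ Fin n) H :=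
  ((m ! * n ! : ℂ)⁻¹) • ∑ π : Equiv.Perm (Fin m), ∑ σ : Equiv.Perm (Fin n),
    pureTensor (Sum.elim (x ∘ π) (y ∘ σ))

variable (H) in
/-- The closed subspace `H^{⊙m} ⊗ H^{⊙n}` of `H^{⊗(m+n)}`. -/
def symmetricTensors (m n : ℕ) : Submodule ℂ (HilbertTensor (Fin m ⊕ Fin n) H) :=
  (Submodule.span ℂ
    {t | ∃ (x : Fin m → H) (y : Fin n → H), t = symmetrizedTensor x y}).topologicalClosure

end Tensor

/-! ### Complex Hermite polynomials -/

/-- The complex Hermite polynomial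
`J_{m,n}(z, ρ) = ∑_{r ≤ min(m, n)} (-1)^r r! C(m, r) C(n, r) z^{m-r} z̄^{n-r} ρ^r`. -/
def complexHermite (m n : ℕ) (z : ℂ) (ρ : ℝ) : ℂ :=
  ∑ r ∈ Finset.range (min m n + 1),
    (-1) ^ r * (r ! : ℂ) * (m.choose r : ℂ) * (n.choose r : ℂ) *
      z ^ (m - r) * conj z ^ (n - r) * (ρ : ℂ) ^ r

/-! ### Complex Gaussian isonormal processes -/

section Isonormal

variable {Ω : Type*} [MeasurableSpace Ω] {P : Measure Ω}
  {H : Type*} [NormedAddCommGroup H] [InnerProductSpace ℂ H]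

/-- `Z = {Z(h) : h ∈ H}` is a complex Gaussian isonormal process over `H`: a centered (jointly)
Gaussian family of complex random variables such that `E[Z(h)²] = 0` and
`E[Z(g) * conj Z(h)] = ⟨g, h⟩`, where `⟨g, h⟩ = ⟪h, g⟫_ℂ` is linear in `g`. -/
structure IsComplexIsonormal (Z : H → Ω → ℂ) (P : Measure Ω) : Prop where
  measurable : ∀ h, Measurable (Z h)
  gaussian : IsGaussianProcess Z P
  centered : ∀ h, ∫ ω, Z h ω ∂P = 0
  symm : ∀ h, ∫ ω, Z h ω ^ 2 ∂P = 0
  covariance : ∀ g h, ∫ ω, Z g ω * conj (Z h ω) ∂P = ⟪h, g⟫_ℂ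

/-- The σ-algebra `σ(Z)` generated by the process. -/
abbrev sigmaAlgebra (Z : H → Ω → ℂ) : MeasurableSpace Ω :=
  ⨆ h, MeasurableSpace.comap (Z h) inferInstance

/-! ### Complex multiple Wiener–Itô integrals -/

section Integral

variable {ι : Type*}

open Classical in
/-- The Fourier–Hermite polynomial
`J_{α,β} = ∏ₖ (2^{α_k + β_k} α_k! β_k!)^{-1/2} J_{α_k,β_k}(√2 Z(e_k))` (with `ρ = 2`), for
multi-indices `α`, `β`; all factors with `α_k = β_k = 0` are equal to `1`. -/
def fourierHermite (Z : H → Ω → ℂ) (e : ι → H) (α β : ι →₀ ℕ) (ω : Ω) : ℂ :=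
  ∏ k ∈ α.support ∪ β.support,
    ((√(2 ^ (α k + β k) * (α k)! * (β k)!) : ℝ) : ℂ)⁻¹ *
      complexHermite (α k) (β k) ((√2 : ℝ) * Z (e k) ω) 2

theorem memLp_mul {f g : Ω → ℂ} (hf : ∀ p : ℝ≥0∞, p ≠ ∞ → MemLp f p P)
    (hg : ∀ p : ℝ≥0∞, p ≠ ∞ → MemLp g p P) (p : ℝ≥0∞) (hp : p ≠ ∞) :
    MemLp (fun ω => f ω * g ω) p P := by
  have h2 : (2 * p) ≠ ∞ := ENNReal.mul_ne_top (by simp) hp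
  have : ENNReal.HolderTriple (2 * p) (2 * p) p := ⟨by
    rw [ENNReal.mul_inv (by simp) (by simp), ← add_mul, ENNReal.inv_two_add_inv_two, one_mul]⟩
  exact (hg _ h2).mul (hf _ h2)

theorem memLp_fourierHermite [IsProbabilityMeasure P] {Z : H → Ω → ℂ} (hZ : IsComplexIsonormal Z P)
    (e : ι → H) (α β : ι →₀ ℕ) : MemLp (fourierHermite Z e α β) 2 P := by
  classical
  have hconst : ∀ (c : ℂ) (p : ℝ≥0∞), p ≠ ∞ → MemLp (fun _ : Ω => c) p P :=
    fun c p _ => memLp_const c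
  have hpow : ∀ (f : Ω → ℂ), (∀ p : ℝ≥0∞, p ≠ ∞ → MemLp f p P) → ∀ (k : ℕ) (p : ℝ≥0∞), p ≠ ∞ →
      MemLp (fun ω => f ω ^ k) p P := by
    intro f hf k
    induction k with
    | zero => simpa using hconst 1
    | succ k ih =>
      simp only [pow_succ]
      exact memLp_mul ih hf
  have hprod : ∀ (s : Finset ι) (f : ι → Ω → ℂ),
      (∀ k, ∀ p : ℝ≥0∞, p ≠ ∞ → MemLp (f k) p P) → ∀ p : ℝ≥0∞, p ≠ ∞ →
      MemLp (fun ω => ∏ k ∈ s, f k ω) p P := by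
    intro s f hf
    induction s using Finset.induction_on with
    | empty => simpa using hconst 1
    | insert a s ha ih =>
      simp only [Finset.prod_insert ha]
      exact memLp_mul (hf a) ih
  refine hprod _ _ (fun k => memLp_mul (hconst _) fun p hp => ?_) 2 (by simp)
  have hX : ∀ p : ℝ≥0∞, p ≠ ∞ → MemLp (fun ω => ((√2 : ℝ) : ℂ) * Z (e k) ω) p P :=
    memLp_mul (hconst _) fun p hp => (hZ.gaussian.hasGaussianLaw_eval (e k)).memLp hp
  unfold complexHermite
  refine memLp_finsetSum _ fun r _ => ?_
  exact memLp_mul (memLp_mul (memLp_mul (hconst _) (hpow _ hX _))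
    (hpow _ (fun p hp => (hX p hp).star) _)) (hconst _) p hp

/-- The multi-index counting how often each `k : ι` occurs in the tuple `j`. -/
def occupation {m : ℕ} (j : Fin m → ι) : ι →₀ ℕ := ∑ i, Finsupp.single (j i) 1

/-- `α! = ∏ₖ α_k!`. -/
def multiFactorial (α : ι →₀ ℕ) : ℕ := α.prod fun _ a => a !

/-- The integral `I_{m,n}((⊙ₖ e_k^{⊗ α_k}) ⊗ (⊙ₖ ē_k^{⊗ β_k})) = √(α! β!) J_{α,β}` of a
symmetrized product of basis vectors, as an element of `L²(Ω)`. -/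
def basisIntegral [IsProbabilityMeasure P] {Z : H → Ω → ℂ} (hZ : IsComplexIsonormal Z P)
    (e : ι → H) (α β : ι →₀ ℕ) : Lp ℂ 2 P :=
  ((√(multiFactorial α * multiFactorial β : ℝ) : ℝ) : ℂ) • (memLp_fourierHermite hZ e α β).toLp

/-- The terms of the expansion of `I_{m,n}(f)` in the orthonormal basis
`e_{j₁} ⊗ … ⊗ e_{j_m} ⊗ ē_{l₁} ⊗ … ⊗ ē_{l_n}` of `H^{⊗(m+n)}`: the coefficient of `f`
times the integral of the symmetrization of this basis vector. Here `c` is the complex conjugation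
`h ↦ h̄` of `H`. -/
def integralTerm [IsProbabilityMeasure P] {Z : H → Ω → ℂ} (hZ : IsComplexIsonormal Z P)
    (c : H → H) (e : ι → H) {m n : ℕ} (f : HilbertTensor (Fin m ⊕ Fin n) H)
    (jl : (Fin m → ι) × (Fin n → ι)) : Lp ℂ 2 P :=
  ⟪pureTensor (Sum.elim (fun i => e (jl.1 i)) (fun i => c (e (jl.2 i)))), f⟫_ℂ •
    basisIntegral hZ e (occupation jl.1) (occupation jl.2)

/-- The complex multiple Wiener–Itô integral `I_{m,n}(f)` with respect to `Z`. -/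
def multipleIntegral [IsProbabilityMeasure P] {Z : H → Ω → ℂ} (hZ : IsComplexIsonormal Z P)
    (c : H → H) (e : ι → H) {m n : ℕ} (f : HilbertTensor (Fin m ⊕ Fin n) H) : Lp ℂ 2 P :=
  ∑' jl, integralTerm hZ c e f jl

end Integral

/-! ### Malliavin derivatives, divergences and Ornstein–Uhlenbeck operators

The (unbounded) operators are represented by their graphs. -/

/-- The Wirtinger derivative `∂f/∂z_j = (∂f/∂x_j - i ∂f/∂y_j) / 2`. -/
def wirtinger {k : ℕ} (j : Fin k) (f : (Fin k → ℂ) → ℂ) (z : Fin k → ℂ) : ℂ :=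
  (fderiv ℝ f z (Pi.single j 1) - Complex.I * fderiv ℝ f z (Pi.single j Complex.I)) / 2

/-- The Wirtinger derivative `∂f/∂z̄_j = (∂f/∂x_j + i ∂f/∂y_j) / 2`. -/
def wirtingerBar {k : ℕ} (j : Fin k) (f : (Fin k → ℂ) → ℂ) (z : Fin k → ℂ) : ℂ :=
  (fderiv ℝ f z (Pi.single j 1) + Complex.I * fderiv ℝ f z (Pi.single j Complex.I)) / 2

/-- The pairs `(F, DF)` with `F = f(Z(v₁), …, Z(v_k))` a smooth random variable (`f` is smooth and
all its partial derivatives have polynomial growth) and `DF = ∑ᵢ ∂ᵢ f(Z(v₁), …, Z(v_k)) vᵢ`. -/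
def smoothPairs (Z : H → Ω → ℂ) (P : Measure Ω) : Set (Lp ℂ 2 P × Lp H 2 P) :=
  {p | ∃ (k : ℕ) (v : Fin k → H) (f : (Fin k → ℂ) → ℂ), f.HasTemperateGrowth ∧
    (p.1 =ᵐ[P] fun ω => f fun i => Z (v i) ω) ∧
    (p.2 =ᵐ[P] fun ω => ∑ j, wirtinger j f (fun i => Z (v i) ω) • v j)}

/-- The pairs `(F, D̄F)` with `F = f(Z(v₁), …, Z(v_k))` a smooth random variable and
`D̄F = ∑ᵢ ∂̄ᵢ f(Z(v₁), …, Z(v_k)) v̄ᵢ`, where `c` is the complex conjugation `h ↦ h̄` of `H`. -/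
def smoothPairsBar (Z : H → Ω → ℂ) (P : Measure Ω) (c : H → H) : Set (Lp ℂ 2 P × Lp H 2 P) :=
  {p | ∃ (k : ℕ) (v : Fin k → H) (f : (Fin k → ℂ) → ℂ), f.HasTemperateGrowth ∧
    (p.1 =ᵐ[P] fun ω => f fun i => Z (v i) ω) ∧
    (p.2 =ᵐ[P] fun ω => ∑ j, wirtingerBar j f (fun i => Z (v i) ω) • c (v j))}

/-- The graph of the divergence operator which is adjoint to the derivative with pairs
`S = {(F, DF)}`: the pairs `(u, G)` with `u ∈ L²(Ω; H)`, `G ∈ L²(Ω, σ(Z), P)` and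
`E[G * conj F] = E[⟨u, DF⟩]` for all smooth `F`. For `u` given, such a `G` exists if and only if
`|E[⟨DF, u⟩]| ≤ C ‖F‖` for all smooth `F` and some constant `C`. -/
def divergenceGraph (Z : H → Ω → ℂ) (P : Measure Ω) (S : Set (Lp ℂ 2 P × Lp H 2 P)) :
    Set (Lp H 2 P × Lp ℂ 2 P) :=
  {q | q.2 ∈ lpMeas ℂ ℂ (sigmaAlgebra Z) 2 P ∧ ∀ p ∈ S,
    ∫ ω, q.2 ω * conj (p.1 ω) ∂P = ∫ ω, ⟪p.2 ω, q.1 ω⟫_ℂ ∂P}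

/-- The graph of the Malliavin derivative `D : 𝔻^{1,2} → L²(Ω; H)`, the closure of the derivative
of smooth random variables. -/
def malliavinGraph (Z : H → Ω → ℂ) (P : Measure Ω) : Set (Lp ℂ 2 P × Lp H 2 P) :=
  closure (smoothPairs Z P)

/-- The graph of the Malliavin derivative `D̄`. -/
def malliavinGraphBar (Z : H → Ω → ℂ) (P : Measure Ω) (c : H → H) :
    Set (Lp ℂ 2 P × Lp H 2 P) :=
  closure (smoothPairsBar Z P c)

/-- The graph of the complex Ornstein–Uhlenbeck operator `L = δ D`, with domain
`{F ∈ Dom D : DF ∈ Dom δ}`. -/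
def ornsteinUhlenbeckGraph (Z : H → Ω → ℂ) (P : Measure Ω) : Set (Lp ℂ 2 P × Lp ℂ 2 P) :=
  {q | ∃ u : Lp H 2 P, (q.1, u) ∈ malliavinGraph Z P ∧
    (u, q.2) ∈ divergenceGraph Z P (smoothPairs Z P)}

/-- The graph of the complex Ornstein–Uhlenbeck operator `L̄ = δ̄ D̄`. -/
def ornsteinUhlenbeckGraphBar (Z : H → Ω → ℂ) (P : Measure Ω) (c : H → H) :
    Set (Lp ℂ 2 P × Lp ℂ 2 P) :=
  {q | ∃ u : Lp H 2 P, (q.1, u) ∈ malliavinGraphBar Z P c ∧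
    (u, q.2) ∈ divergenceGraph Z P (smoothPairsBar Z P c)}

end Isonormal

end

end ComplexWiener

/-! With the stated normalization, the integral of a symmetrized basis tensor is a product of
Hermite polynomials `J_{a,b}(Z(e_k), 1)` (`basisIntegral_eq_hermiteLp`). Write `H_{α,β}` for this
product and `ε_k` for the k-th unit multi-index. Two facts drive everything: the recursion
`J_{m+1,n} = z J_{m,n} - n J_{m,n-1}`, and the formula `∂J_{m,n}/∂z = m J_{m-1,n}`, which it
implies.

The formula gives `D H_{α,β} = ∑ₖ α_k H_{α-ε_k,β} e_k`. Gaussian integration by parts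
(`SmoothPair.integral_mul_conj`) together with the recursion gives `δ(H_{α-ε_k,β} e_k) = H_{α,β}`
whenever `α_k > 0`. Hence `L H_{α,β} = |α| H_{α,β}` (`exists_deriv_hermiteLp`), and every term of
the series for `I_{m,n}(f)` has `|α| = m`.

The coefficients of `f` are square summable by Bessel. The vectors `H_{α,β}` are bounded, and two of
them are orthogonal unless their multi-indices agree, which happens only for boundedly many index
tuples. So the series converges unconditionally (`summable_smul_of_almost_orthogonal`). On finite
partial sums `F` one has `‖DF‖² = m‖F‖²`, so the derivatives converge too, and closedness of `D` and
`δ` gives the eigenvalue equation for the sum (`mem_ornsteinUhlenbeckGraph_tsum`).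

The value is unique because pairing `LF` with a smooth `Φ` gives a continuous functional of `F`, and
smooth variables are total in `L²(σ(Z))` (`ornsteinUhlenbeckGraph_unique`). The statement for `L̄`
follows by conjugation, which exchanges `D` with `D̄` and `m` with `n`. -/

namespace ComplexWiener

noncomputable section

/-! ### Functions of temperate growth -/

section TemperateGrowth

variable {E F : Type*} [NormedAddCommGroup E] [NormedSpace ℝ E] [NormedAddCommGroup F]
  [NormedSpace ℝ F]

theorem hasTemperateGrowth_fderiv {f : E → F} (hf : f.HasTemperateGrowth) :
    (fderiv ℝ f).HasTemperateGrowth := by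
  refine ⟨hf.1.fderiv_right (by simp), fun n => ?_⟩
  obtain ⟨k, C, h⟩ := hf.2 (n + 1)
  exact ⟨k, C, fun x => by simpa [norm_iteratedFDeriv_fderiv] using h x⟩

theorem hasTemperateGrowth_conj {f : E → ℂ} (hf : f.HasTemperateGrowth) :
    (fun x => conj (f x)).HasTemperateGrowth :=
  (Complex.conjCLE.toContinuousLinearMap.hasTemperateGrowth).comp hf

/-- All derivatives have modulus one. This makes characters of finitely many `Z(h)` admissible test
variables in the totality argument. -/
theorem hasTemperateGrowth_cexp_ofReal_mul_I :
    (fun t : ℝ => Complex.exp (t * Complex.I)).HasTemperateGrowth := by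
  have hsmooth : ContDiff ℝ ⊤ (fun t : ℝ => Complex.exp (t * Complex.I)) :=
    (Complex.ofRealCLM.contDiff.mul contDiff_const).cexp
  refine ⟨hsmooth.of_le le_top, fun n => ⟨0, 1, fun x => ?_⟩⟩
  have key : ∀ n : ℕ, iteratedDeriv n (fun t : ℝ => Complex.exp (t * Complex.I)) =
      fun t : ℝ => Complex.I ^ n * Complex.exp (t * Complex.I) := by
    intro n
    induction n with
    | zero => simp
    | succ n ih =>
      rw [iteratedDeriv_succ, ih]
      funext t
      have h1 : HasDerivAt (fun t : ℝ => (t : ℂ) * Complex.I) (1 * Complex.I) t :=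
        (Complex.ofRealCLM.hasDerivAt (x := t)).mul_const Complex.I
      rw [(h1.cexp.const_mul (Complex.I ^ n)).deriv]
      ring
  rw [norm_iteratedFDeriv_eq_norm_iteratedDeriv, key]
  simp [Complex.norm_exp]

theorem HasTemperateGrowth.exists_norm_le {f : E → F} (hf : f.HasTemperateGrowth) :
    ∃ (k : ℕ) (C : ℝ), ∀ x, ‖f x‖ ≤ C * (1 + ‖x‖) ^ k := by
  obtain ⟨k, C, h⟩ := hf.2 0
  exact ⟨k, C, fun x => by simpa using h x⟩

variable [MeasurableSpace E] [BorelSpace E] [SecondCountableTopology E] [CompleteSpace E]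
  {μ : Measure E} [IsGaussian μ]

/-- Gaussian measures have moments of all orders, so this power dominates any function of temperate
growth. -/
theorem memLp_one_add_norm_pow (k : ℕ) (p : ℝ≥0∞) (hp : p ≠ ∞) :
    MemLp (fun x : E => (((1 + ‖x‖) ^ k : ℝ) : ℂ)) p μ := by
  induction k generalizing p with
  | zero => simpa using memLp_const (1 : ℂ)
  | succ k ih =>
    simp only [pow_succ, Complex.ofReal_mul]
    refine memLp_mul (fun p hp => ih p hp) (fun p hp => ?_) p hp
    exact ((memLp_const (1 : ℝ)).add (IsGaussian.memLp_id μ p hp).norm).ofReal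

theorem HasTemperateGrowth.memLp {f : E → F} (hf : f.HasTemperateGrowth)
    (p : ℝ≥0∞) (hp : p ≠ ∞) : MemLp f p μ := by
  obtain ⟨k, C, h⟩ := HasTemperateGrowth.exists_norm_le hf
  refine ((memLp_one_add_norm_pow (μ := μ) k p hp).const_mul (C : ℂ)).mono
    hf.1.continuous.aestronglyMeasurable (.of_forall fun x => (h x).trans ?_)
  rw [← Complex.ofReal_mul, Complex.norm_real]
  exact le_abs_self _

theorem HasTemperateGrowth.integrable {f : E → F} (hf : f.HasTemperateGrowth) :
    Integrable f μ :=
  memLp_one_iff_integrable.1 (HasTemperateGrowth.memLp hf 1 (by simp))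

end TemperateGrowth

/-! ### Gaussian integration by parts -/

section IntegrationByParts

variable {E : Type*} [NormedAddCommGroup E] [NormedSpace ℝ E]

theorem norm_rotation_le (θ : ℝ) (w : E × E) : ‖ContinuousLinearMap.rotation θ w‖ ≤ 2 * ‖w‖ := by
  have h1 := norm_fst_le w
  have h2 := norm_snd_le w
  have hc := Real.abs_cos_le_one θ
  have hs := Real.abs_sin_le_one θ
  have hb : ∀ (a b : ℝ), |a| ≤ 1 → |b| ≤ 1 → ‖a • w.1 + b • w.2‖ ≤ 2 * ‖w‖ := by
    intro a b ha hb
    refine (norm_add_le _ _).trans ?_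
    rw [norm_smul, norm_smul, Real.norm_eq_abs, Real.norm_eq_abs, two_mul]
    exact add_le_add (((mul_le_of_le_one_left (norm_nonneg _) ha)).trans h1)
      (((mul_le_of_le_one_left (norm_nonneg _) hb)).trans h2)
  rw [ContinuousLinearMap.rotation_apply, Prod.norm_def]
  exact max_le (hb _ _ hc hs) (hb _ _ (by simpa using hs) hc)

theorem hasDerivAt_rotation (θ : ℝ) (w : E × E) :
    HasDerivAt (fun θ => ContinuousLinearMap.rotation θ w)
      ((ContinuousLinearMap.rotation θ w).2, -(ContinuousLinearMap.rotation θ w).1) θ := by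
  simp only [ContinuousLinearMap.rotation_apply]
  have hc := (Real.hasDerivAt_cos θ)
  have hs := (Real.hasDerivAt_sin θ)
  refine (((hc.smul_const w.1).add (hs.smul_const w.2)).prodMk
    ((hs.neg.smul_const w.1).add (hc.smul_const w.2))).congr_deriv ?_
  simp only [neg_add, neg_smul]

variable [MeasurableSpace E] [BorelSpace E] [SecondCountableTopology E] [CompleteSpace E]
  {μ : Measure E} [IsGaussian μ]

/-- Integration by parts for a centered Gaussian measure. -/
theorem integral_mul_clm_eq (hμ : μ[id] = 0) {f : E → ℂ} (hf : f.HasTemperateGrowth)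
    (l : E →L[ℝ] ℂ) :
    ∫ x, f x * l x ∂μ = ∫ w, fderiv ℝ f w.1 w.2 * l w.2 ∂(μ.prod μ) := by
  set R : ℝ → E × E →L[ℝ] E × E := ContinuousLinearMap.rotation with hR
  -- Rotate the pair `(x, y)` of independent copies by the angle `θ`: the `θ`-derivative of the
  -- rotated `Φ` is the rotated `Ψ`.
  let Φ : E × E → ℂ := fun w => f w.1 * l w.2
  let Ψ : E × E → ℂ := fun w => fderiv ℝ f w.1 w.2 * l w.2 - f w.1 * l w.1
  have hfst : (fun w : E × E => w.1).HasTemperateGrowth :=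
    (ContinuousLinearMap.fst ℝ E E).hasTemperateGrowth
  have hsnd : (fun w : E × E => w.2).HasTemperateGrowth :=
    (ContinuousLinearMap.snd ℝ E E).hasTemperateGrowth
  have h1 : (fun w : E × E => f w.1).HasTemperateGrowth := hf.comp hfst
  have h2 : (fun w : E × E => fderiv ℝ f w.1 w.2).HasTemperateGrowth :=
    (ContinuousLinearMap.id ℝ (E →L[ℝ] ℂ)).bilinear_hasTemperateGrowth
      ((hasTemperateGrowth_fderiv hf).comp hfst) hsnd
  have h3 : (fun w : E × E => l w.2).HasTemperateGrowth := l.hasTemperateGrowth.comp hsnd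
  have h4 : (fun w : E × E => l w.1).HasTemperateGrowth := l.hasTemperateGrowth.comp hfst
  have hΦ : Φ.HasTemperateGrowth := h1.mul h3
  have hΨ : Ψ.HasTemperateGrowth := (h2.mul h3).sub (h1.mul h4)
  obtain ⟨k, C, hC⟩ := HasTemperateGrowth.exists_norm_le hΨ
  have hC0 : 0 ≤ C := by simpa using (norm_nonneg _).trans (hC 0)
  have hdiff : ∀ w : E × E, ∀ θ : ℝ, HasDerivAt (fun θ => Φ (R θ w)) (Ψ (R θ w)) θ := by
    intro w θ
    have hr := hasDerivAt_rotation θ w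
    have hf' := (hf.1.differentiable (by simp) (R θ w).1).hasFDerivAt
    have ha := hf'.comp_hasDerivAt θ hr.fst
    have hb := l.hasFDerivAt.comp_hasDerivAt θ hr.snd
    refine (ha.mul hb).congr_deriv ?_
    simp only [Ψ, map_neg, Function.comp_apply]
    ring
  have hbound : Integrable (fun w : E × E => C * (1 + 2 * ‖w‖) ^ k) (μ.prod μ) := by
    refine Integrable.mono' (g := fun w => C * 2 ^ k * ‖(((1 + ‖w‖) ^ k : ℝ) : ℂ)‖) ?_ ?_ ?_
    · exact ((memLp_one_iff_integrable.1
        (memLp_one_add_norm_pow (μ := μ.prod μ) k 1 (by simp))).norm).const_mul _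
    · fun_prop
    · refine .of_forall fun w => ?_
      rw [Complex.norm_real, Real.norm_of_nonneg (by positivity),
        Real.norm_of_nonneg (by positivity), mul_assoc, ← mul_pow]
      gcongr
      linarith
  have hderiv := (hasDerivAt_integral_of_dominated_loc_of_deriv_le (μ := μ.prod μ) (x₀ := (0 : ℝ))
    (F := fun θ w => Φ (R θ w)) (F' := fun θ w => Ψ (R θ w)) (s := Set.univ)
    (bound := fun w => C * (1 + 2 * ‖w‖) ^ k) Filter.univ_mem
    (.of_forall fun θ => (hΦ.1.continuous.comp (R θ).continuous).aestronglyMeasurable)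
    (HasTemperateGrowth.integrable (hΦ.comp (R 0).hasTemperateGrowth))
    (hΨ.1.continuous.comp (R 0).continuous).aestronglyMeasurable
    (.of_forall fun w θ _ => by
      refine (hC _).trans ?_
      have := norm_rotation_le θ w
      gcongr) hbound
    (.of_forall fun w θ _ => hdiff w θ)).2
  -- A centered `μ ⊗ μ` is rotation invariant, so this expectation does not depend on `θ`. Its
  -- derivative at `0`, the integral of `Ψ`, therefore vanishes, which is the claim.
  have hconst : ∀ θ, ∫ w, Φ (R θ w) ∂(μ.prod μ) = ∫ w, Φ w ∂(μ.prod μ) := by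
    intro θ
    conv_rhs => rw [← IsGaussian.map_rotation_eq_self hμ θ]
    rw [integral_map (R θ).continuous.aemeasurable hΦ.1.continuous.aestronglyMeasurable]
  simp only [hconst] at hderiv
  have h0 := hderiv.unique (hasDerivAt_const _ _)
  have hR0 : ∀ w, R 0 w = w := fun w => by simp [hR, ContinuousLinearMap.rotation_apply]
  simp only [hR0, Ψ] at h0
  have hi1 : Integrable (fun w : E × E => fderiv ℝ f w.1 w.2 * l w.2) (μ.prod μ) :=
    HasTemperateGrowth.integrable (h2.mul h3)
  have hi2 : Integrable (fun w : E × E => f w.1 * l w.1) (μ.prod μ) :=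
    HasTemperateGrowth.integrable (h1.mul h4)
  rw [integral_sub hi1 hi2, sub_eq_zero] at h0
  rw [h0]
  have := integral_prod_mul (μ := μ) (ν := μ) (fun x => f x * l x) (fun _ => (1 : ℂ))
  simpa using this.symm

end IntegrationByParts

/-! ### Wirtinger derivatives -/

section Wirtinger

variable {E : Type*} [NormedAddCommGroup E] [NormedSpace ℂ E]

/-- The complex-linear part of a real-linear functional. -/
def linearPart (L : E →L[ℝ] ℂ) : E →L[ℂ] ℂ where
  toFun y := (L y - Complex.I * L (Complex.I • y)) / 2
  map_add' x y := by simp only [smul_add, map_add]; ring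
  map_smul' a y := by
    have h : ∀ z : E, L (a • z) = a.re * L z + a.im * L (Complex.I • z) := by
      intro z
      conv_lhs => rw [← Complex.re_add_im a]
      have h1 : ((a.re : ℂ) + a.im * Complex.I) • z = a.re • z + a.im • (Complex.I • z) := by
        rw [add_smul, mul_smul]; rfl
      rw [h1, map_add, map_smul, map_smul, Complex.real_smul, Complex.real_smul]
    rw [smul_comm, h, h, smul_smul, Complex.I_mul_I, neg_one_smul, map_neg, RingHom.id_apply,
      smul_eq_mul]
    conv_rhs => rw [← Complex.re_add_im a]
    ring_nf
    simp only [Complex.I_sq]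
    ring
  cont := by fun_prop

theorem linearPart_apply (L : E →L[ℝ] ℂ) (y : E) :
    linearPart L y = (L y - Complex.I * L (Complex.I • y)) / 2 := rfl

/-- A real-linear functional is a complex-linear part plus an antilinear part, and the latter is the
conjugate of the linear part of `conj ∘ L`. -/
theorem eq_linearPart_add (L : E →L[ℝ] ℂ) (y : E) :
    L y = linearPart L y +
      conj (linearPart (Complex.conjCLE.toContinuousLinearMap.comp L) y) := by
  simp only [linearPart_apply, ContinuousLinearMap.comp_apply, ContinuousLinearEquiv.coe_coe,
    Complex.conjCLE_apply, map_div₀, map_sub, map_mul, Complex.conj_I, Complex.conj_conj]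
  simp only [map_ofNat]
  ring

theorem wirtinger_eq_linearPart {k : ℕ} (j : Fin k) (f : (Fin k → ℂ) → ℂ) (z : Fin k → ℂ) :
    wirtinger j f z = linearPart (fderiv ℝ f z) (Pi.single j 1) := by
  rw [linearPart_apply, wirtinger, ← Pi.single_smul, smul_eq_mul, mul_one]

theorem linearPart_eq_sum_wirtinger {k : ℕ} (f : (Fin k → ℂ) → ℂ) (z y : Fin k → ℂ) :
    linearPart (fderiv ℝ f z) y = ∑ j, y j * wirtinger j f z := by
  have h := LinearMap.pi_apply_eq_sum_univ (linearPart (fderiv ℝ f z)).toLinearMap y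
  simp only [ContinuousLinearMap.coe_coe, smul_eq_mul] at h
  rw [h]
  refine Finset.sum_congr rfl fun j _ => ?_
  rw [wirtinger_eq_linearPart]
  congr 3
  ext i
  simp [Pi.single_apply, eq_comm]

theorem wirtingerBar_eq_conj {k : ℕ} (j : Fin k) {f : (Fin k → ℂ) → ℂ} (hf : Differentiable ℝ f)
    (z : Fin k → ℂ) : wirtingerBar j f z = conj (wirtinger j (fun x => conj (f x)) z) := by
  have h : fderiv ℝ (fun x => conj (f x)) z =
      Complex.conjCLE.toContinuousLinearMap.comp (fderiv ℝ f z) :=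
    (Complex.conjCLE.toContinuousLinearMap.hasFDerivAt.comp z (hf z).hasFDerivAt).fderiv
  simp [wirtinger, wirtingerBar, h, map_ofNat]

theorem hasTemperateGrowth_wirtinger {k : ℕ} (j : Fin k) {f : (Fin k → ℂ) → ℂ}
    (hf : f.HasTemperateGrowth) : (wirtinger j f).HasTemperateGrowth := by
  have h : ∀ y, (fun z => fderiv ℝ f z y).HasTemperateGrowth := fun y =>
    (ContinuousLinearMap.apply ℝ ℂ y).hasTemperateGrowth.comp (hasTemperateGrowth_fderiv hf)
  have h' := ((h (Pi.single j 1)).sub ((Function.HasTemperateGrowth.const Complex.I).mul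
    (h (Pi.single j Complex.I)))).mul (Function.HasTemperateGrowth.const (2⁻¹ : ℂ))
  exact h'

end Wirtinger

section CircularIntegrationByParts

variable {E : Type*} [NormedAddCommGroup E] [NormedSpace ℂ E] [MeasurableSpace E] [BorelSpace E]
  [SecondCountableTopology E] [CompleteSpace E] {μ : Measure E} [IsGaussian μ]

/-- Integration by parts for a centered circularly symmetric Gaussian measure. -/
theorem integral_mul_conj_clm_eq (hμ : μ[id] = 0)
    (hcirc : ∀ A B : E →L[ℂ] ℂ, ∫ y, A y * B y ∂μ = 0) {f : E → ℂ} (hf : f.HasTemperateGrowth)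
    (A : E →L[ℂ] ℂ) :
    ∫ x, f x * conj (A x) ∂μ =
      ∫ x, linearPart (fderiv ℝ f x) (∫ y, conj (A y) • y ∂μ) ∂μ := by
  have hA : (fun y => conj (A y)).HasTemperateGrowth :=
    hasTemperateGrowth_conj (A.restrictScalars ℝ).hasTemperateGrowth
  refine (integral_mul_clm_eq hμ hf
    (Complex.conjCLE.toContinuousLinearMap.comp (A.restrictScalars ℝ))).trans ?_
  have hfst : (fun w : E × E => w.1).HasTemperateGrowth :=
    (ContinuousLinearMap.fst ℝ E E).hasTemperateGrowth
  have hsnd : (fun w : E × E => w.2).HasTemperateGrowth :=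
    (ContinuousLinearMap.snd ℝ E E).hasTemperateGrowth
  have h2 : (fun w : E × E => fderiv ℝ f w.1 w.2).HasTemperateGrowth :=
    (ContinuousLinearMap.id ℝ (E →L[ℝ] ℂ)).bilinear_hasTemperateGrowth
      ((hasTemperateGrowth_fderiv hf).comp hfst) hsnd
  refine (integral_prod _ (HasTemperateGrowth.integrable (h2.mul (hA.comp hsnd)))).trans ?_
  refine integral_congr_ae (.of_forall fun x => ?_)
  have hint : Integrable (fun y => conj (A y) • y) μ :=
    HasTemperateGrowth.integrable (hA.smul .id')
  have hlin : ∀ B : E →L[ℂ] ℂ, (fun y => B y).HasTemperateGrowth := fun B =>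
    (B.restrictScalars ℝ).hasTemperateGrowth
  beta_reduce
  rw [← (linearPart (fderiv ℝ f x)).integral_comp_comm hint]
  simp only [Pi.mul_apply, Function.comp_apply, map_smul, smul_eq_mul]
  set B := linearPart (fderiv ℝ f x)
  set B' := linearPart (Complex.conjCLE.toContinuousLinearMap.comp (fderiv ℝ f x)) with hB'
  -- The antilinear part of the derivative contributes the conjugate of a product of two
  -- complex-linear functionals, whose mean is zero by `hcirc`. Only the Wirtinger derivative in `z`
  -- survives.
  have : ∀ y, fderiv ℝ f x y * conj (A y) = conj (A y) * B y + conj (B' y * A y) := by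
    intro y
    rw [eq_linearPart_add (fderiv ℝ f x) y, map_mul]
    ring
  simp only [this]
  have hi1 : Integrable (fun y => conj (A y) * B y) μ :=
    HasTemperateGrowth.integrable (hA.mul (hlin B))
  have hi2 : Integrable (fun y => conj (B' y * A y)) μ :=
    HasTemperateGrowth.integrable (hasTemperateGrowth_conj ((hlin B').mul (hlin A)))
  rw [integral_add hi1 hi2, integral_conj, hcirc, map_zero, add_zero]

end CircularIntegrationByParts

/-! ### Smooth random variables -/

section SmoothPair

variable {Ω : Type*} {H : Type*} [NormedAddCommGroup H] [InnerProductSpace ℂ H] {Z : H → Ω → ℂ}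

/-- `F` is a smooth random variable with derivative `U`, both understood pointwise. -/
def SmoothPair (Z : H → Ω → ℂ) (F : Ω → ℂ) (U : Ω → H) : Prop :=
  ∃ (k : ℕ) (v : Fin k → H) (f : (Fin k → ℂ) → ℂ), f.HasTemperateGrowth ∧
    (F = fun ω => f fun i => Z (v i) ω) ∧
    (U = fun ω => ∑ j, wirtinger j f (fun i => Z (v i) ω) • v j)

section Calculus

variable {E E' : Type*} [NormedAddCommGroup E] [NormedSpace ℂ E] [NormedAddCommGroup E']
  [NormedSpace ℂ E']

theorem linearPart_fderiv_add {f g : E → ℂ} (hf : Differentiable ℝ f) (hg : Differentiable ℝ g)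
    (z y : E) : linearPart (fderiv ℝ (fun x => f x + g x) z) y =
      linearPart (fderiv ℝ f z) y + linearPart (fderiv ℝ g z) y := by
  rw [fderiv_fun_add (hf z) (hg z)]
  simp only [linearPart_apply, FunLike.coe_add, Pi.add_apply]
  ring

theorem linearPart_fderiv_mul {f g : E → ℂ} (hf : Differentiable ℝ f) (hg : Differentiable ℝ g)
    (z y : E) : linearPart (fderiv ℝ (fun x => f x * g x) z) y =
      f z * linearPart (fderiv ℝ g z) y + g z * linearPart (fderiv ℝ f z) y := by
  rw [fderiv_fun_mul (hf z) (hg z)]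
  simp only [linearPart_apply, FunLike.coe_add, Pi.add_apply, FunLike.coe_smul, Pi.smul_apply,
    smul_eq_mul]
  ring

theorem linearPart_fderiv_comp {f : E' → ℂ} (hf : Differentiable ℝ f) (L : E →L[ℂ] E')
    (z y : E) : linearPart (fderiv ℝ (fun x => f (L x)) z) y =
      linearPart (fderiv ℝ f (L z)) (L y) := by
  have h := ((hf (L z)).hasFDerivAt.comp z (L.restrictScalars ℝ).hasFDerivAt).fderiv
  have h' : fderiv ℝ (fun x => f (L x)) z = (fderiv ℝ f (L z)).comp (L.restrictScalars ℝ) := h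
  rw [h']
  simp [linearPart_apply]

/-- The pullback of functions along a map of index sets. -/
def pullback {κ κ' : Type*} (s : κ → κ') : (κ' → ℂ) →L[ℂ] (κ → ℂ) :=
  ContinuousLinearMap.pi fun i => ContinuousLinearMap.proj (s i)

@[simp]
theorem pullback_apply {κ κ' : Type*} (s : κ → κ') (x : κ' → ℂ) (i : κ) :
    pullback s x i = x (s i) := rfl

theorem hasTemperateGrowth_pullback {κ κ' : Type*} [Fintype κ] [Fintype κ'] (s : κ → κ') :
    (fun x => pullback s x).HasTemperateGrowth :=
  ((pullback s).restrictScalars ℝ).hasTemperateGrowth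

/-- The chain rule: coordinates outside the range of `s` contribute nothing, so dummy variables do
not change the derivative. -/
theorem sum_wirtinger_pullback {k l : ℕ} (s : Fin k → Fin l) {f : (Fin k → ℂ) → ℂ}
    (hf : Differentiable ℝ f) (u : Fin l → H) (z : Fin l → ℂ) :
    ∑ j, wirtinger j (fun x => f (pullback s x)) z • u j =
      ∑ i, wirtinger i f (pullback s z) • u (s i) := by
  simp only [wirtinger_eq_linearPart (f := fun x => f (pullback s x)),
    linearPart_fderiv_comp hf, linearPart_eq_sum_wirtinger, Finset.sum_smul]
  rw [Finset.sum_comm]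
  refine Finset.sum_congr rfl fun i _ => ?_
  rw [Finset.sum_eq_single (s i)]
  · simp
  · intro j _ hj
    simp [hj.symm]
  · simp

end Calculus

/-- Concatenating the two lists of vectors lets both variables be functions of the same arguments,
which reduces sums and products to calculus on one `ℂ^k`. -/
theorem SmoothPair.exists_common {F G : Ω → ℂ} {U V : Ω → H} (hF : SmoothPair Z F U)
    (hG : SmoothPair Z G V) : ∃ (k : ℕ) (v : Fin k → H) (f g : (Fin k → ℂ) → ℂ),
      f.HasTemperateGrowth ∧ g.HasTemperateGrowth ∧
      (F = fun ω => f fun i => Z (v i) ω) ∧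
      (U = fun ω => ∑ j, wirtinger j f (fun i => Z (v i) ω) • v j) ∧
      (G = fun ω => g fun i => Z (v i) ω) ∧
      (V = fun ω => ∑ j, wirtinger j g (fun i => Z (v i) ω) • v j) := by
  obtain ⟨k, v, f, hf, rfl, rfl⟩ := hF
  obtain ⟨l, w, g, hg, rfl, rfl⟩ := hG
  refine ⟨k + l, Fin.append v w, fun x => f (pullback (Fin.castAdd l) x),
    fun x => g (pullback (Fin.natAdd k) x),
    hf.comp (hasTemperateGrowth_pullback _), hg.comp (hasTemperateGrowth_pullback _),
    ?_, ?_, ?_, ?_⟩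
  · funext ω
    congr 1
    funext i
    simp
  · funext ω
    rw [sum_wirtinger_pullback _ (hf.1.differentiable (by simp))]
    simp only [Fin.append_left]
    congr! 4
    simp
  · funext ω
    congr 1
    funext i
    simp
  · funext ω
    rw [sum_wirtinger_pullback _ (hg.1.differentiable (by simp))]
    simp only [Fin.append_right]
    congr! 4
    simp

theorem SmoothPair.add {F G : Ω → ℂ} {U V : Ω → H} (hF : SmoothPair Z F U)
    (hG : SmoothPair Z G V) : SmoothPair Z (fun ω => F ω + G ω) (fun ω => U ω + V ω) := by
  obtain ⟨k, v, f, g, hf, hg, rfl, rfl, rfl, rfl⟩ := hF.exists_common hG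
  refine ⟨k, v, fun x => f x + g x, hf.add hg, rfl, ?_⟩
  funext ω
  simp only [wirtinger_eq_linearPart]
  rw [← Finset.sum_add_distrib]
  refine Finset.sum_congr rfl fun j _ => ?_
  rw [linearPart_fderiv_add (hf.1.differentiable (by simp)) (hg.1.differentiable (by simp)),
    add_smul]

theorem SmoothPair.mul {F G : Ω → ℂ} {U V : Ω → H} (hF : SmoothPair Z F U)
    (hG : SmoothPair Z G V) :
    SmoothPair Z (fun ω => F ω * G ω) (fun ω => F ω • V ω + G ω • U ω) := by
  obtain ⟨k, v, f, g, hf, hg, rfl, rfl, rfl, rfl⟩ := hF.exists_common hG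
  refine ⟨k, v, fun x => f x * g x, hf.mul hg, rfl, ?_⟩
  funext ω
  simp only [wirtinger_eq_linearPart]
  rw [Finset.smul_sum, Finset.smul_sum, ← Finset.sum_add_distrib]
  refine Finset.sum_congr rfl fun j _ => ?_
  rw [linearPart_fderiv_mul (hf.1.differentiable (by simp)) (hg.1.differentiable (by simp)),
    add_smul, smul_smul, smul_smul]

theorem smoothPair_const (Z : H → Ω → ℂ) (a : ℂ) :
    SmoothPair Z (fun _ => a) (fun _ => 0) :=
  ⟨0, Fin.elim0, fun _ => a, .const a, rfl, by simp⟩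

theorem SmoothPair.const_mul {F : Ω → ℂ} {U : Ω → H} (hF : SmoothPair Z F U) (a : ℂ) :
    SmoothPair Z (fun ω => a * F ω) (fun ω => a • U ω) := by
  simpa using (smoothPair_const Z a).mul hF

theorem smoothPair_eval (Z : H → Ω → ℂ) (h : H) : SmoothPair Z (Z h) (fun _ => h) := by
  refine ⟨1, fun _ => h, fun z => z 0,
    (ContinuousLinearMap.proj 0 : (Fin 1 → ℂ) →L[ℝ] ℂ).hasTemperateGrowth, rfl, ?_⟩
  funext ω
  have : fderiv ℝ (fun z : Fin 1 → ℂ => z 0) = fun _ => ContinuousLinearMap.proj 0 := by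
    funext z
    exact (ContinuousLinearMap.proj 0 : (Fin 1 → ℂ) →L[ℝ] ℂ).fderiv
  simp [wirtinger, this]

theorem smoothPair_conj_eval (Z : H → Ω → ℂ) (h : H) :
    SmoothPair Z (fun ω => conj (Z h ω)) (fun _ => 0) := by
  refine ⟨1, fun _ => h, fun z => conj (z 0),
    hasTemperateGrowth_conj (f := fun z : Fin 1 → ℂ => z 0)
    (ContinuousLinearMap.proj 0 : (Fin 1 → ℂ) →L[ℝ] ℂ).hasTemperateGrowth, rfl, ?_⟩
  funext ω
  have : fderiv ℝ (fun z : Fin 1 → ℂ => conj (z 0)) =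
      fun _ => Complex.conjCLE.toContinuousLinearMap.comp (ContinuousLinearMap.proj 0) := by
    funext z
    exact (Complex.conjCLE.toContinuousLinearMap.comp
      (ContinuousLinearMap.proj 0 : (Fin 1 → ℂ) →L[ℝ] ℂ)).fderiv
  simp [wirtinger, this]

theorem SmoothPair.prod {κ : Type*} [DecidableEq κ] (s : Finset κ) {F : κ → Ω → ℂ}
    {U : κ → Ω → H} (h : ∀ i ∈ s, SmoothPair Z (F i) (U i)) :
    SmoothPair Z (fun ω => ∏ i ∈ s, F i ω)
      (fun ω => ∑ i ∈ s, (∏ j ∈ s.erase i, F j ω) • U i ω) := by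
  induction s using Finset.induction_on with
  | empty => simpa using smoothPair_const Z 1
  | insert a s ha ih =>
    have h1 := (h a (by simp)).mul (ih fun i hi => h i (by simp [hi]))
    convert h1 using 1
    · funext ω
      rw [Finset.prod_insert ha]
    · funext ω
      rw [Finset.sum_insert ha, Finset.erase_insert ha, add_comm, Finset.smul_sum]
      congr 1
      refine Finset.sum_congr rfl fun i hi => ?_
      have hia : a ≠ i := fun h => ha (h ▸ hi)
      rw [Finset.erase_insert_of_ne hia, Finset.prod_insert (by simp [ha]), smul_smul]

theorem SmoothPair.pow {F : Ω → ℂ} {U : Ω → H} (h : SmoothPair Z F U) (n : ℕ) :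
    SmoothPair Z (fun ω => F ω ^ n) (fun ω => ((n : ℂ) * F ω ^ (n - 1)) • U ω) := by
  induction n with
  | zero => simpa using smoothPair_const Z 1
  | succ n ih =>
    convert ih.mul h using 1
    · funext ω
      rw [pow_succ]
    · funext ω
      rw [smul_smul, ← add_smul]
      congr 1
      cases n with
      | zero => simp
      | succ n =>
        simp only [Nat.add_sub_cancel]
        push_cast
        ring

/-- The conjugate of a smooth random variable is smooth. -/
theorem SmoothPair.exists_conj {F : Ω → ℂ} {U : Ω → H} (h : SmoothPair Z F U) :
    ∃ V, SmoothPair Z (fun ω => conj (F ω)) V := by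
  obtain ⟨k, v, f, hf, rfl, rfl⟩ := h
  exact ⟨_, k, v, fun x => conj (f x), hasTemperateGrowth_conj hf, rfl, rfl⟩

theorem SmoothPair.stronglyMeasurable_sigmaAlgebra {F : Ω → ℂ} {U : Ω → H}
    (h : SmoothPair Z F U) : StronglyMeasurable[sigmaAlgebra Z] F := by
  obtain ⟨k, v, f, hf, rfl, rfl⟩ := h
  have hZm : ∀ h, Measurable[sigmaAlgebra Z] (Z h) := fun h =>
    measurable_iff_comap_le.2 (le_iSup (fun h => MeasurableSpace.comap (Z h) inferInstance) h)
  exact (hf.1.continuous.measurable.comp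
    (@measurable_pi_lambda Ω (Fin k) (fun _ => ℂ) (sigmaAlgebra Z) _ _
      fun i => hZm (v i))).stronglyMeasurable

end SmoothPair

/-! ### Integration by parts for smooth random variables -/

section Isonormal

variable {Ω : Type*} [MeasurableSpace Ω] {P : Measure Ω}
  {H : Type*} [NormedAddCommGroup H] [InnerProductSpace ℂ H] {Z : H → Ω → ℂ}

theorem mem_smoothPairs_iff {p : Lp ℂ 2 P × Lp H 2 P} :
    p ∈ smoothPairs Z P ↔ ∃ F U, SmoothPair Z F U ∧ p.1 =ᵐ[P] F ∧ p.2 =ᵐ[P] U := by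
  constructor
  · rintro ⟨k, v, f, hf, h1, h2⟩
    exact ⟨_, _, ⟨k, v, f, hf, rfl, rfl⟩, h1, h2⟩
  · rintro ⟨_, _, ⟨k, v, f, hf, rfl, rfl⟩, h1, h2⟩
    exact ⟨k, v, f, hf, h1, h2⟩

theorem sigmaAlgebra_le (hZ : IsComplexIsonormal Z P) :
    sigmaAlgebra Z ≤ (inferInstance : MeasurableSpace Ω) :=
  iSup_le fun h => (hZ.measurable h).comap_le

theorem IsComplexIsonormal.isGaussian_map (hZ : IsComplexIsonormal Z P) {κ : Type*} [Fintype κ]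
    (u : κ → H) : IsGaussian (P.map fun ω i => Z (u i) ω) := by
  classical
  have h := hZ.gaussian.hasGaussianLaw (Finset.univ.image u)
  let I : Finset H := Finset.univ.image u
  have hI : ∀ i, u i ∈ I := fun i => by simp [I]
  let L : ((i : I) → ℂ) →L[ℝ] (κ → ℂ) :=
    ContinuousLinearMap.pi fun i => ContinuousLinearMap.proj (⟨u i, hI i⟩ : I)
  exact (h.map L).isGaussian_map

theorem IsComplexIsonormal.measurable_pi (hZ : IsComplexIsonormal Z P) {κ : Type*}
    (u : κ → H) : Measurable fun ω i => Z (u i) ω :=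
  measurable_pi_lambda _ fun i => hZ.measurable (u i)

theorem IsComplexIsonormal.memLp (hZ : IsComplexIsonormal Z P) (h : H) (p : ℝ≥0∞) (hp : p ≠ ∞) :
    MemLp (Z h) p P :=
  (hZ.gaussian.hasGaussianLaw_eval h).memLp hp

theorem IsComplexIsonormal.memLp_comp (hZ : IsComplexIsonormal Z P) {κ : Type*} [Fintype κ]
    (u : κ → H) {F : Type*} [NormedAddCommGroup F] [NormedSpace ℝ F]
    {f : (κ → ℂ) → F} (hf : f.HasTemperateGrowth) (p : ℝ≥0∞) (hp : p ≠ ∞) :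
    MemLp (fun ω => f fun i => Z (u i) ω) p P := by
  have := hZ.isGaussian_map u
  exact (HasTemperateGrowth.memLp (μ := P.map fun ω i => Z (u i) ω) hf p hp).comp_of_map
    (hZ.measurable_pi u).aemeasurable

theorem SmoothPair.memLp (hZ : IsComplexIsonormal Z P) {F : Ω → ℂ} {U : Ω → H}
    (h : SmoothPair Z F U) (p : ℝ≥0∞) (hp : p ≠ ∞) : MemLp F p P := by
  obtain ⟨k, v, f, hf, rfl, rfl⟩ := h
  exact hZ.memLp_comp v hf p hp

theorem SmoothPair.memLp_inner (hZ : IsComplexIsonormal Z P) {F : Ω → ℂ} {U : Ω → H}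
    (hU : SmoothPair Z F U) (h : H) (p : ℝ≥0∞) (hp : p ≠ ∞) :
    MemLp (fun ω => ⟪h, U ω⟫_ℂ) p P := by
  obtain ⟨k, v, f, hf, rfl, rfl⟩ := hU
  simp only [inner_sum, inner_smul_right]
  exact memLp_finsetSum _ fun j _ =>
    ((hZ.memLp_comp v (hasTemperateGrowth_wirtinger j hf) p hp).mul_const _)

theorem SmoothPair.memLp_deriv (hZ : IsComplexIsonormal Z P) {F : Ω → ℂ} {U : Ω → H}
    (hU : SmoothPair Z F U) (p : ℝ≥0∞) (hp : p ≠ ∞) : MemLp U p P := by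
  obtain ⟨k, v, f, hf, rfl, rfl⟩ := hU
  refine memLp_finsetSum _ fun j _ => ?_
  exact (ContinuousLinearMap.toSpanSingleton ℂ (v j)).comp_memLp'
    (hZ.memLp_comp v (hasTemperateGrowth_wirtinger j hf) p hp)

theorem integrable_mul_of_memLp {F G : Ω → ℂ} (hF : MemLp F 2 P) (hG : MemLp G 2 P) :
    Integrable (fun ω => F ω * G ω) P :=
  memLp_one_iff_integrable.1 (hG.mul' hF)

/-- Additivity is forced by the covariance: the defect `Z(g+h) - Z(g) - Z(h)` is orthogonal to every
`Z(y)`, hence to itself. -/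
theorem IsComplexIsonormal.eval_add_ae (hZ : IsComplexIsonormal Z P) (g h : H) :
    Z (g + h) =ᵐ[P] fun ω => Z g ω + Z h ω := by
  have hm : ∀ h, MemLp (Z h) 2 P := fun h => hZ.memLp h 2 (by simp)
  have hi : ∀ g h, Integrable (fun ω => Z g ω * conj (Z h ω)) P := fun g h =>
    integrable_mul_of_memLp (hm g) (hm h).star
  set D : Ω → ℂ := fun ω => Z (g + h) ω - Z g ω - Z h ω with hD
  have hDm : MemLp D 2 P := ((hm _).sub (hm _)).sub (hm _)
  have hDZ : ∀ y, ∫ ω, D ω * conj (Z y ω) ∂P = 0 := by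
    intro y
    simp only [hD, sub_mul]
    rw [integral_sub (f := fun ω => Z (g + h) ω * conj (Z y ω) - Z g ω * conj (Z y ω))
      ((hi _ _).sub (hi _ _)) (hi _ _), integral_sub (hi _ _) (hi _ _)]
    simp only [hZ.covariance, inner_add_right]
    ring
  have hDi : ∀ y, Integrable (fun ω => D ω * conj (Z y ω)) P := fun y =>
    integrable_mul_of_memLp hDm (hm y).star
  have h0 : ∫ ω, D ω * conj (D ω) ∂P = 0 := by
    have : ∀ ω, D ω * conj (D ω) =
        D ω * conj (Z (g + h) ω) - D ω * conj (Z g ω) - D ω * conj (Z h ω) := by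
      intro ω
      simp only [hD, map_sub]
      ring
    simp only [this]
    rw [integral_sub (f := fun ω => D ω * conj (Z (g + h) ω) - D ω * conj (Z g ω))
      ((hDi _).sub (hDi _)) (hDi _), integral_sub (hDi _) (hDi _)]
    simp [hDZ]
  simp only [Complex.mul_conj, integral_complex_ofReal, Complex.ofReal_eq_zero] at h0
  rw [integral_eq_zero_iff_of_nonneg (fun ω => Complex.normSq_nonneg _)] at h0
  · filter_upwards [h0] with ω hω
    have : Z (g + h) ω - Z g ω - Z h ω = 0 := Complex.normSq_eq_zero.1 hω
    rw [sub_sub, sub_eq_zero] at this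
    exact this
  · have := (integrable_mul_of_memLp hDm hDm.star).re
    refine this.congr (.of_forall fun ω => ?_)
    simp [Complex.mul_conj]

/-- Polarization of `E[Z(h)²] = 0`, using additivity of `Z` up to null sets. -/
theorem IsComplexIsonormal.integral_mul_eq_zero (hZ : IsComplexIsonormal Z P) (g h : H) :
    ∫ ω, Z g ω * Z h ω ∂P = 0 := by
  have hm : ∀ h, MemLp (Z h) 2 P := fun h => hZ.memLp h 2 (by simp)
  have hi : ∀ g h, Integrable (fun ω => Z g ω * Z h ω) P := fun g h =>
    integrable_mul_of_memLp (hm g) (hm h)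
  have h1 := hZ.symm (g + h)
  have h2 : ∫ ω, Z (g + h) ω ^ 2 ∂P =
      ∫ ω, Z g ω * Z g ω + Z h ω * Z h ω + 2 * (Z g ω * Z h ω) ∂P := by
    refine integral_congr_ae ?_
    filter_upwards [hZ.eval_add_ae g h] with ω hω
    rw [hω]
    ring
  rw [h2, integral_add (f := fun ω => Z g ω * Z g ω + Z h ω * Z h ω)
    ((hi _ _).add (hi _ _)) ((hi _ _).const_mul _),
    integral_add (hi _ _) (hi _ _), integral_const_mul] at h1
  have h3 : ∀ g, ∫ ω, Z g ω * Z g ω ∂P = 0 := fun g => by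
    simpa only [sq] using hZ.symm g
  simpa [h3] using h1

/-- Integration by parts for functions of finitely many variables of an isonormal process. -/
theorem IsComplexIsonormal.integral_comp_mul_conj (hZ : IsComplexIsonormal Z P) {κ : Type*}
    [Fintype κ] (u : κ → H) {f : (κ → ℂ) → ℂ} (hf : f.HasTemperateGrowth) (i : κ) :
    ∫ ω, f (fun i => Z (u i) ω) * conj (Z (u i) ω) ∂P =
      ∫ ω, linearPart (fderiv ℝ f fun i => Z (u i) ω) (fun j => ⟪u i, u j⟫_ℂ) ∂P := by
  classical
  set X : Ω → κ → ℂ := fun ω i => Z (u i) ω with hX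
  have hXm : Measurable X := hZ.measurable_pi u
  have hG : IsGaussian (P.map X) := hZ.isGaussian_map u
  have hpull : ∀ {g : (κ → ℂ) → ℂ},
      Continuous g → ∫ x, g x ∂(P.map X) = ∫ ω, g (X ω) ∂P := fun {g} hg =>
    integral_map hXm.aemeasurable hg.aestronglyMeasurable
  have heval : ∀ {g : (κ → ℂ) → κ → ℂ}, Continuous g → Integrable g (P.map X) →
      ∀ j, (∫ x, g x ∂(P.map X)) j = ∫ ω, g (X ω) j ∂P := by
    intro g hg hgi j
    rw [← hpull (g := fun x => g x j) ((continuous_apply j).comp hg)]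
    exact ((ContinuousLinearMap.proj j : (κ → ℂ) →L[ℝ] ℂ).integral_comp_comm hgi).symm
  have hmean : (P.map X)[id] = 0 := by
    funext j
    rw [heval continuous_id IsGaussian.integrable_id]
    exact hZ.centered _
  have hcirc : ∀ A B : (κ → ℂ) →L[ℂ] ℂ, ∫ y, A y * B y ∂(P.map X) = 0 := by
    intro A B
    rw [hpull (g := fun y => A y * B y) (by fun_prop)]
    have hexp : ∀ (A : (κ → ℂ) →L[ℂ] ℂ) y, A y = ∑ j, y j * A (Pi.single j 1) := by
      intro A y
      have h := LinearMap.pi_apply_eq_sum_univ A.toLinearMap y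
      simp only [ContinuousLinearMap.coe_coe, smul_eq_mul] at h
      rw [h]
      refine Finset.sum_congr rfl fun j _ => ?_
      congr 2
      ext i
      simp [Pi.single_apply, eq_comm]
    have : ∀ ω, A (X ω) * B (X ω) = ∑ i, ∑ j,
        (Z (u i) ω * Z (u j) ω) * (A (Pi.single i 1) * B (Pi.single j 1)) := by
      intro ω
      rw [hexp A, hexp B, Finset.sum_mul_sum]
      refine Finset.sum_congr rfl fun i _ => Finset.sum_congr rfl fun j _ => ?_
      ring
    simp only [this]
    have hi : ∀ i j, Integrable (fun ω => (Z (u i) ω * Z (u j) ω) *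
        (A (Pi.single i 1) * B (Pi.single j 1))) P := fun i j =>
      (integrable_mul_of_memLp (hZ.memLp _ 2 (by simp)) (hZ.memLp _ 2 (by simp))).mul_const _
    rw [integral_finsetSum _ fun i _ => integrable_finsetSum _ fun j _ => hi i j]
    refine Finset.sum_eq_zero fun i _ => ?_
    rw [integral_finsetSum _ fun j _ => hi i j]
    refine Finset.sum_eq_zero fun j _ => ?_
    rw [integral_mul_const, hZ.integral_mul_eq_zero, zero_mul]
  let A : (κ → ℂ) →L[ℂ] ℂ := ContinuousLinearMap.proj i
  -- The direction of differentiation in the abstract formula is the `i`-th column of the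
  -- covariance.
  have hb : ∫ y, conj (A y) • y ∂(P.map X) = fun j => ⟪u i, u j⟫_ℂ := by
    have hA : (fun y => conj (A y)).HasTemperateGrowth :=
      hasTemperateGrowth_conj (A.restrictScalars ℝ).hasTemperateGrowth
    funext j
    rw [heval (g := fun y => conj (A y) • y)
      ((Complex.continuous_conj.comp A.continuous).smul continuous_id)
      (HasTemperateGrowth.integrable (hA.smul .id')), ← hZ.covariance]
    simp only [Pi.smul_apply, smul_eq_mul, mul_comm]
    rfl
  have h := integral_mul_conj_clm_eq hmean hcirc hf A
  rw [hb] at h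
  have hc1 : Continuous fun x => f x * conj (A x) :=
    hf.1.continuous.mul (Complex.continuous_conj.comp A.continuous)
  have hc2 : Continuous fun x => linearPart (fderiv ℝ f x) (fun j => ⟪u i, u j⟫_ℂ) := by
    have : Continuous (fderiv ℝ f) := hf.1.continuous_fderiv (by simp)
    simp only [linearPart_apply]
    fun_prop
  rw [hpull hc1, hpull hc2] at h
  exact h

/-- Integration by parts for products of smooth random variables. -/
theorem SmoothPair.integral_mul_conj (hZ : IsComplexIsonormal Z P) {F G : Ω → ℂ} {U V : Ω → H}
    (hF : SmoothPair Z F U) (hG : SmoothPair Z G V) (h : H) :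
    ∫ ω, ⟪h, U ω⟫_ℂ * G ω ∂P =
      ∫ ω, F ω * (G ω * conj (Z h ω) - ⟪h, V ω⟫_ℂ) ∂P := by
  have hFm := hF.memLp hZ
  have hGm := hG.memLp hZ
  have hU := hF.memLp_inner hZ h
  have hV := hG.memLp_inner hZ h
  have hZc : ∀ p : ℝ≥0∞, p ≠ ∞ → MemLp (fun ω => conj (Z h ω)) p P := fun p hp =>
    (hZ.memLp h p hp).star
  have hi1 : Integrable (fun ω => F ω * (G ω * conj (Z h ω))) P :=
    integrable_mul_of_memLp (hFm 2 (by simp)) (memLp_mul hGm hZc 2 (by simp))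
  have hi2 : Integrable (fun ω => F ω * ⟪h, V ω⟫_ℂ) P :=
    integrable_mul_of_memLp (hFm 2 (by simp)) (hV 2 (by simp))
  have hi3 : Integrable (fun ω => ⟪h, U ω⟫_ℂ * G ω) P :=
    integrable_mul_of_memLp (hU 2 (by simp)) (hGm 2 (by simp))
  have key : ∫ ω, F ω * (G ω * conj (Z h ω)) ∂P =
      ∫ ω, F ω * ⟪h, V ω⟫_ℂ + ⟪h, U ω⟫_ℂ * G ω ∂P := by
    obtain ⟨k, v, f, hf, hF1, hU1⟩ := hF.mul hG
    -- The vector `h` need not be among the arguments of `F * G`. It is adjoined as a dummy variable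
    -- with index `none`.
    have := hZ.integral_comp_mul_conj (κ := Option (Fin k)) (fun i => i.elim h v)
      (f := fun x => f (pullback some x))
      (hf.comp (hasTemperateGrowth_pullback some)) none
    simp only [linearPart_fderiv_comp (hf.1.differentiable (by simp)),
      linearPart_eq_sum_wirtinger, Option.elim_none] at this
    convert this using 1
    · refine integral_congr_ae (.of_forall fun ω => ?_)
      have := congrFun hF1 ω
      beta_reduce
      rw [← mul_assoc, this]
      congr 2
    · refine integral_congr_ae (.of_forall fun ω => ?_)
      have := congrArg (fun x => ⟪h, x⟫_ℂ) (congrFun hU1 ω)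
      simp only [inner_add_right, inner_smul_right, inner_sum] at this
      beta_reduce
      rw [mul_comm _ (G ω), this]
      refine Finset.sum_congr rfl fun j _ => ?_
      rw [mul_comm]
      congr 1
  simp only [mul_sub]
  rw [integral_sub hi1 hi2, key, integral_add hi2 hi3]
  ring

end Isonormal

/-! ### Totality of smooth random variables -/

section Density

theorem exists_smoothPair {Ω κ H : Type*} [NormedAddCommGroup H] [InnerProductSpace ℂ H]
    [Fintype κ] (Z : H → Ω → ℂ) (u : κ → H)
    {f : (κ → ℂ) → ℂ} (hf : f.HasTemperateGrowth) :
    ∃ U, SmoothPair Z (fun ω => f fun i => Z (u i) ω) U := by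
  let s := Fintype.equivFin κ
  refine ⟨_, _, u ∘ s.symm, fun x => f (pullback s x), hf.comp (hasTemperateGrowth_pullback s),
    ?_, rfl⟩
  funext ω
  congr 1
  funext i
  simp

theorem sigmaAlgebra_eq_comap {Ω H : Type*} (Z : H → Ω → ℂ) :
    sigmaAlgebra Z = MeasurableSpace.comap (fun ω h => Z h ω) MeasurableSpace.pi := by
  simp only [MeasurableSpace.pi, MeasurableSpace.comap_iSup, MeasurableSpace.comap_comp]
  rfl

variable {Ω : Type*} [MeasurableSpace Ω] {P : Measure Ω}
  {H : Type*} [NormedAddCommGroup H] [InnerProductSpace ℂ H] {Z : H → Ω → ℂ}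

/-- Taking the positive and negative parts of `r` as densities gives two finite measures. Testing
against characters shows that they induce the same law of the whole process, so they agree on
`σ(Z)`. -/
theorem setIntegral_eq_zero_of_smooth (hZ : IsComplexIsonormal Z P) {r : Ω → ℝ}
    (hrm : Measurable r) (hr : Integrable r P)
    (h : ∀ F U, SmoothPair Z F U → ∫ ω, (r ω : ℂ) * F ω ∂P = 0) {s : Set Ω}
    (hs : MeasurableSet[sigmaAlgebra Z] s) : ∫ ω in s, r ω ∂P = 0 := by
  classical
  set X : Ω → H → ℂ := fun ω h => Z h ω with hX
  have hXm : Measurable X := measurable_pi_lambda _ hZ.measurable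
  let μ : (Ω → ℝ) → Measure Ω := fun r => P.withDensity fun ω => ENNReal.ofReal (r ω)
  have hfin : ∀ r : Ω → ℝ, Integrable r P → IsFiniteMeasure (μ r) := fun r hr =>
    isFiniteMeasure_withDensity_ofReal hr.2
  have hchar : ∀ r : Ω → ℝ, Measurable r → ∀ (I : Finset H) (L : StrongDual ℝ (I → ℂ)),
      charFunDual (((μ r).map X).map I.restrict) L =
        ∫ ω, (max (r ω) 0 : ℝ) • Complex.exp (L (fun i => Z i ω) * Complex.I) ∂P := by
    intro r hrm I L
    have hR : Measurable (I.restrict : (H → ℂ) → (I → ℂ)) :=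
      measurable_pi_lambda _ fun i => measurable_pi_apply _
    rw [Measure.map_map hR hXm, charFunDual_apply, integral_map (hR.comp hXm).aemeasurable
      (by fun_prop), integral_withDensity_eq_integral_toReal_smul (by fun_prop) (by simp)]
    simp only [ENNReal.toReal_ofReal']
    rfl
  have := hfin r hr
  have hr' := hfin (fun ω => -r ω) hr.neg
  have hlim : (μ r).map X = (μ fun ω => -r ω).map X := by
    -- Finite measures on `H → ℂ` are determined by their finite-dimensional marginals, and these by
    -- their characteristic functions.
    refine IsProjectiveLimit.unique (P := fun I => ((μ r).map X).map I.restrict)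
      (fun I => rfl) (fun I => ?_)
    refine Measure.ext_of_charFunDual ?_
    funext L
    rw [hchar r hrm, hchar (fun ω => -r ω) hrm.neg, ← sub_eq_zero]
    have htg : (fun x : I → ℂ => Complex.exp (L x * Complex.I)).HasTemperateGrowth :=
      hasTemperateGrowth_cexp_ofReal_mul_I.comp L.hasTemperateGrowth
    obtain ⟨U, hU⟩ := exists_smoothPair Z (fun i : I => (i : H)) htg
    have hi : ∀ r : Ω → ℝ, Integrable r P → Integrable (fun ω =>
        (max (r ω) 0 : ℝ) • Complex.exp (L (fun i => Z i ω) * Complex.I)) P := by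
      intro r hr
      refine Integrable.smul_of_top_left hr.pos_part ?_
      refine memLp_top_of_bound (C := 1) ?_ (.of_forall fun ω => by simp [Complex.norm_exp])
      exact (hU.memLp hZ 1 (by simp)).aestronglyMeasurable
    rw [← integral_sub (hi (fun ω => -r ω) hr.neg) (hi r hr)]
    have h0 := h _ _ hU
    rw [← neg_eq_zero, ← integral_neg] at h0
    rw [← h0]
    refine integral_congr_ae (.of_forall fun ω => ?_)
    beta_reduce
    rw [← sub_smul, Complex.real_smul, ← neg_mul]
    congr 1
    rw [← Complex.ofReal_neg]
    congr 1
    rcases le_total (r ω) 0 with h | h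
    · rw [max_eq_right h, max_eq_left (by linarith)]; ring
    · rw [max_eq_left h, max_eq_right (by linarith)]; ring
  rw [sigmaAlgebra_eq_comap] at hs
  obtain ⟨B, hB, rfl⟩ := hs
  have hs' := congrArg (fun ν => ν B) hlim
  simp only [Measure.map_apply hXm hB, μ, withDensity_apply _ (hXm hB)] at hs'
  rw [integral_eq_lintegral_pos_part_sub_lintegral_neg_part hr.integrableOn, hs', sub_self]

/-- Totality of smooth variables in `L²(σ(Z))`. Since they are stable under conjugation, the real
and imaginary parts of `G` annihilate them separately, which reduces to real densities. -/
theorem eq_zero_of_smooth (hZ : IsComplexIsonormal Z P) [IsProbabilityMeasure P] {G : Lp ℂ 2 P}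
    (hG : G ∈ lpMeas ℂ ℂ (sigmaAlgebra Z) 2 P)
    (h : ∀ F U, SmoothPair Z F U → ∫ ω, G ω * F ω ∂P = 0) : G = 0 := by
  have hGi : Integrable G P := (Lp.memLp G).integrable (by simp)
  have hGm : Measurable G := (Lp.stronglyMeasurable G).measurable
  have hc : ∀ F U, SmoothPair Z F U → ∫ ω, conj (G ω) * F ω ∂P = 0 := by
    intro F U hF
    obtain ⟨V, hV⟩ := hF.exists_conj
    have := congrArg conj (h _ _ hV)
    rw [← integral_conj] at this
    simpa using this
  have hi : ∀ F U, SmoothPair Z F U → Integrable (fun ω => G ω * F ω) P := fun F U hF =>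
    integrable_mul_of_memLp (Lp.memLp G) (hF.memLp hZ 2 (by simp))
  have hi' : ∀ F U, SmoothPair Z F U → Integrable (fun ω => conj (G ω) * F ω) P := fun F U hF =>
    integrable_mul_of_memLp (Lp.memLp G).star (hF.memLp hZ 2 (by simp))
  have hre : ∀ F U, SmoothPair Z F U → ∫ ω, ((G ω).re : ℂ) * F ω ∂P = 0 := by
    intro F U hF
    have : ∀ ω, ((G ω).re : ℂ) * F ω = (G ω * F ω + conj (G ω) * F ω) / 2 := by
      intro ω
      rw [Complex.re_eq_add_conj]
      ring
    simp only [this]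
    rw [integral_div, integral_add (hi F U hF) (hi' F U hF), h F U hF, hc F U hF]
    simp
  have him : ∀ F U, SmoothPair Z F U → ∫ ω, ((G ω).im : ℂ) * F ω ∂P = 0 := by
    intro F U hF
    have : ∀ ω, ((G ω).im : ℂ) * F ω = (G ω * F ω - conj (G ω) * F ω) / (2 * Complex.I) := by
      intro ω
      rw [Complex.im_eq_sub_conj]
      ring
    simp only [this]
    rw [integral_div, integral_sub (hi F U hF) (hi' F U hF), h F U hF, hc F U hF]
    simp
  have hzero := lpMeas.ae_eq_zero_of_forall_setIntegral_eq_zero (sigmaAlgebra_le hZ)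
    (⟨G, hG⟩ : lpMeas ℂ ℂ (sigmaAlgebra Z) 2 P) (by simp) (by simp)
    (fun s _ _ => hGi.integrableOn) (fun s hs _ => by
      apply Complex.ext
      · have h1 := setIntegral_eq_zero_of_smooth hZ (Complex.measurable_re.comp hGm) hGi.re hre hs
        have h2 := integral_re (𝕜 := ℂ) (f := G) (μ := P.restrict s) hGi.integrableOn
        exact h2.symm.trans h1
      · have h1 := setIntegral_eq_zero_of_smooth hZ (Complex.measurable_im.comp hGm) hGi.im him hs
        have h2 := integral_im (𝕜 := ℂ) (f := G) (μ := P.restrict s) hGi.integrableOn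
        exact h2.symm.trans h1)
  exact (Lp.eq_zero_iff_ae_eq_zero).2 hzero

end Density

/-! ### The graph of the Ornstein–Uhlenbeck operator -/

section Graph

variable {Ω : Type*} [MeasurableSpace Ω] {P : Measure Ω}
  {H : Type*} [NormedAddCommGroup H] [InnerProductSpace ℂ H] {Z : H → Ω → ℂ}

/-- Integration by parts moves the derivative off `F`: pairing `DF` with a fixed smooth `Ψ` is
`L²`-continuous in `F`. This carries the closability of `D` and the uniqueness of `L`. -/
theorem exists_adjoint_deriv (hZ : IsComplexIsonormal Z P) {Φ : Ω → ℂ} {Ψ : Ω → H}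
    (h : SmoothPair Z Φ Ψ) : ∃ Λ : Ω → ℂ, MemLp Λ 2 P ∧ ∀ F U, SmoothPair Z F U →
      ∫ ω, ⟪Ψ ω, U ω⟫_ℂ ∂P = ∫ ω, F ω * Λ ω ∂P := by
  obtain ⟨k, v, f, hf, rfl, rfl⟩ := h
  have hG : ∀ j, ∃ V, SmoothPair Z (fun ω => conj (wirtinger j f fun i => Z (v i) ω)) V :=
    fun j => ⟨_, _, v, fun x => conj (wirtinger j f x),
      hasTemperateGrowth_conj (hasTemperateGrowth_wirtinger j hf), rfl, rfl⟩
  choose V hV using hG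
  have hΛ : ∀ j, MemLp (fun ω => conj (wirtinger j f fun i => Z (v i) ω) * conj (Z (v j) ω) -
      ⟪v j, V j ω⟫_ℂ) 2 P := fun j =>
    (memLp_mul ((hV j).memLp hZ) (fun p hp => (hZ.memLp (v j) p hp).star) 2 (by simp)).sub
      ((hV j).memLp_inner hZ (v j) 2 (by simp))
  refine ⟨fun ω => ∑ j, (conj (wirtinger j f fun i => Z (v i) ω) * conj (Z (v j) ω) -
      ⟪v j, V j ω⟫_ℂ), memLp_finsetSum _ fun j _ => hΛ j, fun F U hF => ?_⟩
  simp only [sum_inner, inner_smul_left, Finset.mul_sum]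
  have hFm := hF.memLp hZ 2 (by simp)
  rw [integral_finsetSum _ fun j _ => integrable_mul_of_memLp hFm (hΛ j), integral_finsetSum]
  · refine Finset.sum_congr rfl fun j _ => ?_
    rw [← hF.integral_mul_conj hZ (hV j) (v j)]
    simp only [mul_comm]
  · exact fun j _ => integrable_mul_of_memLp ((hV j).memLp hZ 2 (by simp))
      (hF.memLp_inner hZ (v j) 2 (by simp))

theorem mem_divergenceGraph_iff {S : Set (Lp ℂ 2 P × Lp H 2 P)} {q : Lp H 2 P × Lp ℂ 2 P} :
    q ∈ divergenceGraph Z P S ↔ q.2 ∈ lpMeas ℂ ℂ (sigmaAlgebra Z) 2 P ∧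
      ∀ p ∈ S, ⟪p.1, q.2⟫_ℂ = ⟪p.2, q.1⟫_ℂ := by
  simp only [L2.inner_def, RCLike.inner_apply]
  rfl

theorem SmoothPair.exists_mem_smoothPairs (hZ : IsComplexIsonormal Z P) {F : Ω → ℂ} {U : Ω → H}
    (h : SmoothPair Z F U) : ∃ p ∈ smoothPairs Z P, p.1 =ᵐ[P] F ∧ p.2 =ᵐ[P] U := by
  have h1 := (h.memLp hZ 2 (by simp)).coeFn_toLp
  have h2 := (h.memLp_deriv hZ 2 (by simp)).coeFn_toLp
  exact ⟨(_, _), mem_smoothPairs_iff.2 ⟨F, U, h, h1, h2⟩, h1, h2⟩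

/-- The Ornstein–Uhlenbeck operator is single valued. -/
theorem ornsteinUhlenbeckGraph_unique (hZ : IsComplexIsonormal Z P) [IsProbabilityMeasure P]
    {F G G' : Lp ℂ 2 P} (h : (F, G) ∈ ornsteinUhlenbeckGraph Z P)
    (h' : (F, G') ∈ ornsteinUhlenbeckGraph Z P) : G = G' := by
  -- `Λ` depends only on `Φ`. The identity between `⟪DΦ, u⟫` and `⟪Λ, F⟫` holds for smooth pairs
  -- `(F, u)` and is a closed condition, so it persists on the closure. Thus `F` alone determines
  -- the pairing of `G` with `Φ`, whichever `u` was used.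
  have key : ∀ {Φ : Ω → ℂ} {Ψ : Ω → H}, SmoothPair Z Φ Ψ → ∃ Λ : Lp ℂ 2 P,
      ∀ {F G : Lp ℂ 2 P}, (F, G) ∈ ornsteinUhlenbeckGraph Z P →
        ∫ ω, G ω * conj (Φ ω) ∂P = ⟪Λ, F⟫_ℂ := by
    intro Φ Ψ hΦ
    obtain ⟨Λ, hΛm, hΛ⟩ := exists_adjoint_deriv hZ hΦ
    obtain ⟨p, hp, hp1, hp2⟩ := hΦ.exists_mem_smoothPairs hZ
    refine ⟨hΛm.star.toLp _, fun {F G} ⟨u, hu1, hu2⟩ => ?_⟩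
    have h1 : ∫ ω, G ω * conj (Φ ω) ∂P = ⟪p.2, u⟫_ℂ := by
      rw [← (mem_divergenceGraph_iff.1 hu2).2 p hp, L2.inner_def]
      refine integral_congr_ae ?_
      filter_upwards [hp1] with ω hω
      rw [RCLike.inner_apply, hω]
    rw [h1]
    have hclosed : IsClosed {q : Lp ℂ 2 P × Lp H 2 P |
        ⟪p.2, q.2⟫_ℂ = ⟪hΛm.star.toLp _, q.1⟫_ℂ} :=
      isClosed_eq (by fun_prop) (by fun_prop)
    refine closure_minimal ?_ hclosed hu1
    intro q hq
    obtain ⟨F', U', hFU, hq1, hq2⟩ := mem_smoothPairs_iff.1 hq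
    have h2 := hΛ _ _ hFU
    simp only [Set.mem_ofPred_eq, L2.inner_def]
    convert h2 using 1
    · refine integral_congr_ae ?_
      filter_upwards [hp2, hq2] with ω h1 h2
      rw [h1, h2]
    · refine integral_congr_ae ?_
      filter_upwards [hq1, hΛm.star.coeFn_toLp] with ω h1 h2
      rw [h1, h2]
      simp [RCLike.inner_apply]
  have hm : ∀ {G : Lp ℂ 2 P}, (F, G) ∈ ornsteinUhlenbeckGraph Z P →
      G ∈ lpMeas ℂ ℂ (sigmaAlgebra Z) 2 P := fun ⟨_, _, hu⟩ => hu.1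
  rw [← sub_eq_zero]
  refine eq_zero_of_smooth hZ (Submodule.sub_mem _ (hm h) (hm h')) fun Φ Ψ hΦ => ?_
  obtain ⟨V, hV⟩ := hΦ.exists_conj
  obtain ⟨Λ, hΛ⟩ := key hV
  have h1 := hΛ h
  rw [← hΛ h', ← sub_eq_zero] at h1
  simp only [Complex.conj_conj] at h1
  have hΦm := hΦ.memLp hZ 2 (by simp)
  rw [← integral_sub (integrable_mul_of_memLp (Lp.memLp G) hΦm)
    (integrable_mul_of_memLp (Lp.memLp G') hΦm)] at h1
  rw [← h1]
  refine integral_congr_ae ?_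
  filter_upwards [Lp.coeFn_sub G G'] with ω hω
  rw [hω, Pi.sub_apply]
  ring

/-- As for any adjoint, the graph is cut out by continuous linear equations, here together with the
closed condition of `σ(Z)`-measurability. -/
theorem isClosed_divergenceGraph (hZ : IsComplexIsonormal Z P)
    (S : Set (Lp ℂ 2 P × Lp H 2 P)) : IsClosed (divergenceGraph Z P S) := by
  have : divergenceGraph Z P S =
      {q | q.2 ∈ {G : Lp ℂ 2 P | AEStronglyMeasurable[sigmaAlgebra Z] G P}} ∩
        ⋂ p ∈ S, {q | ⟪p.1, q.2⟫_ℂ = ⟪p.2, q.1⟫_ℂ} := by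
    ext q
    rw [mem_divergenceGraph_iff]
    simp [mem_lpMeas_iff_aestronglyMeasurable]
  rw [this]
  refine ((isClosed_aestronglyMeasurable (sigmaAlgebra_le hZ)).preimage continuous_snd).inter ?_
  exact isClosed_biInter fun p _ => isClosed_eq (by fun_prop) (by fun_prop)

/-- The graph of the divergence is a subspace. -/
def divergenceSubmodule (Z : H → Ω → ℂ) (P : Measure Ω) (S : Set (Lp ℂ 2 P × Lp H 2 P)) :
    Submodule ℂ (Lp H 2 P × Lp ℂ 2 P) where
  carrier := divergenceGraph Z P S
  add_mem' {a b} ha hb := by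
    rw [mem_divergenceGraph_iff] at *
    refine ⟨Submodule.add_mem _ ha.1 hb.1, fun p hp => ?_⟩
    rw [Prod.snd_add, Prod.fst_add, inner_add_right, inner_add_right, ha.2 p hp, hb.2 p hp]
  zero_mem' := mem_divergenceGraph_iff.2 ⟨Submodule.zero_mem _, fun p _ => by simp⟩
  smul_mem' c a ha := by
    rw [mem_divergenceGraph_iff] at *
    refine ⟨Submodule.smul_mem _ _ ha.1, fun p hp => ?_⟩
    rw [Prod.smul_snd, Prod.smul_fst, inner_smul_right, inner_smul_right, ha.2 p hp]

/-- The graph of the derivative of smooth random variables is a subspace. -/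
def smoothSubmodule (Z : H → Ω → ℂ) (P : Measure Ω) : Submodule ℂ (Lp ℂ 2 P × Lp H 2 P) where
  carrier := smoothPairs Z P
  add_mem' {a b} ha hb := by
    rw [mem_smoothPairs_iff] at *
    obtain ⟨F, U, h, h1, h2⟩ := ha
    obtain ⟨F', U', h', h1', h2'⟩ := hb
    exact ⟨_, _, h.add h', (Lp.coeFn_add a.1 b.1).trans (h1.add h1'),
      (Lp.coeFn_add a.2 b.2).trans (h2.add h2')⟩
  zero_mem' := mem_smoothPairs_iff.2
    ⟨_, _, smoothPair_const Z 0, Lp.coeFn_zero ℂ 2 P, Lp.coeFn_zero H 2 P⟩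
  smul_mem' c a ha := by
    rw [mem_smoothPairs_iff] at *
    obtain ⟨F, U, h, h1, h2⟩ := ha
    exact ⟨_, _, h.const_mul c, (Lp.coeFn_smul c a.1).trans (h1.const_smul c),
      (Lp.coeFn_smul c a.2).trans (h2.const_smul c)⟩

theorem sum_prodMk {X M N : Type*} [AddCommMonoid M] [AddCommMonoid N] (s : Finset X) (f : X → M)
    (g : X → N) : ∑ x ∈ s, (f x, g x) = (∑ x ∈ s, f x, ∑ x ∈ s, g x) :=
  Prod.ext (by simp [Prod.fst_sum]) (by simp [Prod.snd_sum])

/-- A convergent series of smooth eigenvectors is an eigenvector. -/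
theorem mem_ornsteinUhlenbeckGraph_tsum [CompleteSpace H] (hZ : IsComplexIsonormal Z P)
    {X : Type*} {t : X → Lp ℂ 2 P} {u : X → Lp H 2 P} (m : ℕ)
    (ht : ∀ x, (t x, u x) ∈ smoothPairs Z P)
    (hu : ∀ x, (u x, (m : ℂ) • t x) ∈ divergenceGraph Z P (smoothPairs Z P))
    (hs : Summable t) : (∑' x, t x, (m : ℂ) • ∑' x, t x) ∈ ornsteinUhlenbeckGraph Z P := by
  have hpair : ∀ s : Finset X, (∑ x ∈ s, t x, ∑ x ∈ s, u x) ∈ smoothPairs Z P := by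
    intro s
    have := (smoothSubmodule Z P).sum_mem (t := s) fun x _ => ht x
    rwa [sum_prodMk] at this
  have hdiv : ∀ s : Finset X, (∑ x ∈ s, u x, (m : ℂ) • ∑ x ∈ s, t x) ∈
      divergenceGraph Z P (smoothPairs Z P) := by
    intro s
    have := (divergenceSubmodule Z P (smoothPairs Z P)).sum_mem (t := s) fun x _ => hu x
    rwa [sum_prodMk, ← Finset.smul_sum] at this
  -- Test the divergence of a partial sum of derivatives against the same partial sum of variables:
  -- `⟨F, mF⟩ = ⟨DF, DF⟩`.
  have hnorm : ∀ s : Finset X, ‖∑ x ∈ s, u x‖ ^ 2 = m * ‖∑ x ∈ s, t x‖ ^ 2 := by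
    intro s
    have := (mem_divergenceGraph_iff.1 (hdiv s)).2 _ (hpair s)
    simp only [inner_smul_right, inner_self_eq_norm_sq_to_K] at this
    have h : ((‖∑ x ∈ s, u x‖ ^ 2 : ℝ) : ℂ) = ((m * ‖∑ x ∈ s, t x‖ ^ 2 : ℝ) : ℂ) := by
      push_cast
      exact this.symm
    exact Complex.ofReal_injective h
  have hus : Summable u := by
    rw [summable_iff_vanishing_norm] at hs ⊢
    intro ε hε
    -- The factor is `√m ≤ m + 1`; the shift also covers `m = 0`.
    obtain ⟨s, hs⟩ := hs (ε / (m + 1)) (by positivity)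
    refine ⟨s, fun T hT => ?_⟩
    have h1 := hs T hT
    rw [lt_div_iff₀ (by positivity)] at h1
    refine lt_of_le_of_lt ?_ h1
    refine le_of_sq_le_sq ?_ (by positivity)
    rw [hnorm, mul_pow, mul_comm]
    gcongr
    have : (0 : ℝ) ≤ m := by positivity
    nlinarith
  refine ⟨∑' x, u x, mem_closure_of_tendsto (hs.hasSum.prodMk_nhds hus.hasSum)
    (.of_forall hpair), ?_⟩
  exact (isClosed_divergenceGraph hZ _).mem_of_tendsto
    (hus.hasSum.prodMk_nhds (Filter.Tendsto.const_smul hs.hasSum (m : ℂ))) (.of_forall hdiv)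

end Graph

/-! ### Identities for complex Hermite polynomials -/

section Hermite

theorem complexHermite_eq_sum_range (m n : ℕ) (z : ℂ) {N : ℕ} (hN : min m n + 1 ≤ N) :
    complexHermite m n z 1 = ∑ r ∈ Finset.range N,
      (-1) ^ r * (r ! : ℂ) * (m.choose r : ℂ) * (n.choose r : ℂ) *
        z ^ (m - r) * conj z ^ (n - r) := by
  rw [complexHermite]
  simp only [Complex.ofReal_one, one_pow, mul_one]
  refine Finset.sum_subset (Finset.range_mono hN) fun r _ hr => ?_
  have : min m n < r := by rw [Finset.mem_range] at hr; omega
  rcases min_lt_iff.1 this with h | h <;> simp [Nat.choose_eq_zero_of_lt h]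

/-- Coefficients are compared by Pascal's rule in `m` and `(r+1) C(n,r+1) = n C(n-1,r)`. The
truncated `n - 1` is harmless because of the factor `n`. -/
theorem complexHermite_succ_left (m n : ℕ) (z : ℂ) : complexHermite (m + 1) n z 1 =
    z * complexHermite m n z 1 - n * complexHermite m (n - 1) z 1 := by
  rw [complexHermite_eq_sum_range (m + 1) n z (N := m + 2) (by omega),
    complexHermite_eq_sum_range m n z (N := m + 2) (by omega),
    complexHermite_eq_sum_range m (n - 1) z (N := m + 1) (by omega),
    Finset.sum_range_succ', Finset.sum_range_succ' _ (m + 1), mul_add, Finset.mul_sum,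
    Finset.mul_sum, add_sub_right_comm, ← Finset.sum_sub_distrib]
  congr 1
  · refine Finset.sum_congr rfl fun r hr => ?_
    have hr' : r ≤ m := by simpa [Nat.lt_succ_iff] using hr
    -- For `r = m` the truncated exponents do not match, but the binomial coefficient vanishes.
    have h1 : z ^ (m - r) * (m.choose (r + 1) : ℂ) =
        z * z ^ (m - (r + 1)) * (m.choose (r + 1) : ℂ) := by
      rcases hr'.eq_or_lt with rfl | h
      · simp
      · rw [← pow_succ']
        congr 2
        omega
    have h2 : ((r + 1 : ℕ) : ℂ) * n.choose (r + 1) = n * (n - 1).choose r := by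
      cases n with
      | zero => simp
      | succ n =>
        have := Nat.add_one_mul_choose_eq n r
        rw [Nat.add_sub_cancel, mul_comm]
        exact_mod_cast this.symm
    have h3 : n - (r + 1) = n - 1 - r := by omega
    rw [Nat.choose_succ_succ, Nat.factorial_succ, Nat.add_sub_add_right, h3, Nat.cast_add,
      Nat.cast_mul, pow_succ]
    linear_combination (-1 : ℂ) ^ r * (-1) * (r + 1 : ℕ) * r ! * n.choose (r + 1) *
      conj z ^ (n - 1 - r) * h1 - (-1 : ℂ) ^ r * r ! * m.choose r * z ^ (m - r) *
      conj z ^ (n - 1 - r) * h2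
  · simp [pow_succ']
    ring

theorem conj_complexHermite (m n : ℕ) (z : ℂ) :
    conj (complexHermite m n z 1) = complexHermite n m z 1 := by
  simp only [complexHermite, map_sum, map_mul, map_pow, map_neg, map_one, Complex.conj_natCast,
    Complex.conj_conj, min_comm m n, Complex.conj_ofReal]
  refine Finset.sum_congr rfl fun r _ => ?_
  ring

theorem complexHermite_zero_left (n : ℕ) (z : ℂ) : complexHermite 0 n z 1 = conj z ^ n := by
  simp [complexHermite]

/-- Homogeneity: `z`, `z̄` have degree one and `ρ` degree two. Parameter `1` is the variance
`E|Z(e_k)|²`. -/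
theorem complexHermite_sqrt_two (m n : ℕ) (z : ℂ) : complexHermite m n ((√2 : ℝ) * z) 2 =
    ((√2 : ℝ) : ℂ) ^ (m + n) * complexHermite m n z 1 := by
  have h2 : (((√2 : ℝ) : ℂ)) ^ 2 = 2 := by
    rw [← Complex.ofReal_pow, Real.sq_sqrt (by norm_num)]
    norm_num
  simp only [complexHermite, Finset.mul_sum]
  refine Finset.sum_congr rfl fun r hr => ?_
  have hr' : r ≤ min m n := by simpa [Nat.lt_succ_iff] using hr
  obtain ⟨a, rfl⟩ := Nat.exists_eq_add_of_le (hr'.trans (min_le_left _ _))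
  obtain ⟨b, rfl⟩ := Nat.exists_eq_add_of_le (hr'.trans (min_le_right _ _))
  have h3 : ((√2 : ℝ) : ℂ) ^ (r + a + (r + b)) =
      ((√2 : ℝ) : ℂ) ^ a * ((√2 : ℝ) : ℂ) ^ b * 2 ^ r := by
    rw [← h2]
    ring
  simp only [map_mul, Complex.conj_ofReal, Nat.add_sub_cancel_left, mul_pow, h3]
  push_cast
  ring

variable {Ω H : Type*} [NormedAddCommGroup H] [InnerProductSpace ℂ H]

/-- Differentiating the recursion gives `J_{m,n} + z·m J_{m-1,n} - n·m J_{m-1,n-1}`, which the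
recursion one level lower collapses to `(m+1) J_{m,n}`. The base case `z̄^n` has zero derivative. -/
theorem smoothPair_complexHermite (Z : H → Ω → ℂ) (h : H) (m n : ℕ) :
    SmoothPair Z (fun ω => complexHermite m n (Z h ω) 1)
      (fun ω => ((m : ℂ) * complexHermite (m - 1) n (Z h ω) 1) • h) := by
  induction m generalizing n with
  | zero => simpa [complexHermite_zero_left] using (smoothPair_conj_eval Z h).pow n
  | succ m ih =>
    convert ((smoothPair_eval Z h).mul (ih n)).add ((ih (n - 1)).const_mul (-n)) using 1
    · funext ω
      rw [complexHermite_succ_left]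
      ring
    · funext ω
      rw [smul_smul, smul_smul, ← add_smul, ← add_smul, Nat.add_sub_cancel]
      congr 1
      cases m with
      | zero => simp
      | succ m =>
        rw [Nat.add_sub_cancel, complexHermite_succ_left]
        push_cast
        ring

end Hermite

/-! ### Products of Hermite polynomials -/

section HermiteProduct

variable {Ω H ι : Type*}

open Classical in
/-- The product `∏ₖ J_{α_k,β_k}(Z(e_k), 1)`. -/
def hermiteProduct (Z : H → Ω → ℂ) (e : ι → H) (α β : ι →₀ ℕ) (ω : Ω) : ℂ :=
  ∏ k ∈ α.support ∪ β.support, complexHermite (α k) (β k) (Z (e k) ω) 1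

theorem hermiteProduct_eq_prod (Z : H → Ω → ℂ) (e : ι → H) {α β : ι →₀ ℕ} {K : Finset ι}
    (hα : α.support ⊆ K) (hβ : β.support ⊆ K) (ω : Ω) : hermiteProduct Z e α β ω =
      ∏ k ∈ K, complexHermite (α k) (β k) (Z (e k) ω) 1 := by
  classical
  rw [hermiteProduct]
  refine Finset.prod_subset (Finset.union_subset hα hβ) fun k _ hk => ?_
  simp only [Finset.mem_union, Finsupp.mem_support_iff, not_or, not_not] at hk
  rw [hk.1, hk.2, complexHermite_zero_left, pow_zero]

theorem conj_hermiteProduct (Z : H → Ω → ℂ) (e : ι → H) (α β : ι →₀ ℕ) (ω : Ω) :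
    conj (hermiteProduct Z e α β ω) = hermiteProduct Z e β α ω := by
  classical
  simp only [hermiteProduct, map_prod, conj_complexHermite, Finset.union_comm α.support]

theorem hermiteProduct_add_single (Z : H → Ω → ℂ) (e : ι → H) (α β : ι →₀ ℕ) (k : ι) (ω : Ω) :
    hermiteProduct Z e (α + Finsupp.single k 1) β ω = Z (e k) ω * hermiteProduct Z e α β ω -
      β k * hermiteProduct Z e α (β - Finsupp.single k 1) ω := by
  classical
  set K := insert k (α.support ∪ β.support) with hK
  have hα : α.support ⊆ K := fun j hj => by
    simp only [hK, Finset.mem_insert, Finset.mem_union]; tauto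
  have hβ : β.support ⊆ K := fun j hj => by
    simp only [hK, Finset.mem_insert, Finset.mem_union]; tauto
  have hkK : k ∈ K := by simp [hK]
  have h1 : (α + Finsupp.single k 1).support ⊆ K := by
    refine Finsupp.support_add.trans (Finset.union_subset hα ?_)
    exact Finsupp.support_single_subset.trans (by simpa using hkK)
  have h2 : (β - Finsupp.single k 1).support ⊆ K := by
    refine fun j hj => hβ ?_
    rw [Finsupp.mem_support_iff, Finsupp.tsub_apply] at hj
    rw [Finsupp.mem_support_iff]
    omega
  rw [hermiteProduct_eq_prod Z e h1 hβ, hermiteProduct_eq_prod Z e hα hβ,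
    hermiteProduct_eq_prod Z e hα h2, ← Finset.mul_prod_erase K _ hkK,
    ← Finset.mul_prod_erase K _ hkK, ← Finset.mul_prod_erase K _ hkK]
  have e1 : ∏ j ∈ K.erase k, complexHermite ((α + Finsupp.single k 1 : ι →₀ ℕ) j) (β j)
      (Z (e j) ω) 1 =
      ∏ j ∈ K.erase k, complexHermite (α j) (β j) (Z (e j) ω) 1 := by
    refine Finset.prod_congr rfl fun j hj => ?_
    rw [Finsupp.add_apply, Finsupp.single_eq_of_ne (Finset.ne_of_mem_erase hj), add_zero]
  have e2 : ∏ j ∈ K.erase k, complexHermite (α j) ((β - Finsupp.single k 1 : ι →₀ ℕ) j)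
      (Z (e j) ω) 1 =
      ∏ j ∈ K.erase k, complexHermite (α j) (β j) (Z (e j) ω) 1 := by
    refine Finset.prod_congr rfl fun j hj => ?_
    rw [Finsupp.tsub_apply, Finsupp.single_eq_of_ne (Finset.ne_of_mem_erase hj), tsub_zero]
  rw [e1, e2, Finsupp.add_apply, Finsupp.tsub_apply, Finsupp.single_eq_same,
    complexHermite_succ_left]
  ring

variable [NormedAddCommGroup H] [InnerProductSpace ℂ H]

theorem smoothPair_hermiteProduct (Z : H → Ω → ℂ) (e : ι → H) (α β : ι →₀ ℕ) :
    SmoothPair Z (hermiteProduct Z e α β) (fun ω => ∑ k ∈ α.support,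
      ((α k : ℂ) * hermiteProduct Z e (α - Finsupp.single k 1) β ω) • e k) := by
  classical
  set K := α.support ∪ β.support with hK
  have hα : α.support ⊆ K := Finset.subset_union_left
  have hβ : β.support ⊆ K := Finset.subset_union_right
  convert SmoothPair.prod K fun k _ => smoothPair_complexHermite Z (e k) (α k) (β k) using 1
  · exact funext (hermiteProduct_eq_prod Z e hα hβ)
  funext ω
  rw [← Finset.sum_subset hα]
  · refine Finset.sum_congr rfl fun k hk => ?_
    rw [smul_smul]
    congr 1
    rw [hermiteProduct_eq_prod Z e (K := K) _ hβ, ← Finset.mul_prod_erase K _ (hα hk)]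
    · have : ∏ j ∈ K.erase k, complexHermite ((α - Finsupp.single k 1 : ι →₀ ℕ) j) (β j)
          (Z (e j) ω) 1 =
          ∏ j ∈ K.erase k, complexHermite (α j) (β j) (Z (e j) ω) 1 := by
        refine Finset.prod_congr rfl fun j hj => ?_
        rw [Finsupp.tsub_apply, Finsupp.single_eq_of_ne (Finset.ne_of_mem_erase hj), tsub_zero]
      rw [this, Finsupp.tsub_apply, Finsupp.single_eq_same]
      ring
    · refine fun j hj => hα ?_
      rw [Finsupp.mem_support_iff, Finsupp.tsub_apply] at hj
      rw [Finsupp.mem_support_iff]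
      omega
  · intro k _ hk
    rw [Finsupp.notMem_support_iff.1 hk]
    simp

variable [MeasurableSpace Ω] {P : Measure Ω} {Z : H → Ω → ℂ} {e : ι → H}

theorem memLp_hermiteProduct (hZ : IsComplexIsonormal Z P) (e : ι → H) (α β : ι →₀ ℕ) :
    MemLp (hermiteProduct Z e α β) 2 P :=
  (smoothPair_hermiteProduct Z e α β).memLp hZ 2 (by simp)

theorem inner_sum_support_smul (he : Orthonormal ℂ e) (α : ι →₀ ℕ) (T : ι → ℂ) (k : ι) :
    ⟪e k, ∑ i ∈ α.support, ((α i : ℂ) * T i) • e i⟫_ℂ = α k * T k := by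
  classical
  simp only [inner_sum, inner_smul_right, orthonormal_iff_ite.1 he, mul_ite, mul_one, mul_zero]
  rw [Finset.sum_ite_eq]
  split_ifs with h
  · rfl
  · rw [Finsupp.notMem_support_iff.1 h]
    simp

/-- The creation operators are adjoint to the derivatives in the basis directions. -/
theorem integral_inner_mul_hermiteProduct (hZ : IsComplexIsonormal Z P) (he : Orthonormal ℂ e)
    {Φ : Ω → ℂ} {Ψ : Ω → H} (hΦ : SmoothPair Z Φ Ψ) (α β : ι →₀ ℕ) (k : ι) :
    ∫ ω, ⟪e k, Ψ ω⟫_ℂ * hermiteProduct Z e α β ω ∂P =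
      ∫ ω, Φ ω * hermiteProduct Z e α (β + Finsupp.single k 1) ω ∂P := by
  rw [hΦ.integral_mul_conj hZ (smoothPair_hermiteProduct Z e α β) (e k)]
  refine integral_congr_ae (.of_forall fun ω => ?_)
  beta_reduce
  rw [inner_sum_support_smul he, ← conj_hermiteProduct Z e (β + Finsupp.single k 1),
    hermiteProduct_add_single]
  simp only [map_sub, map_mul, conj_hermiteProduct, Complex.conj_natCast]
  ring

/-- Lowering `α` in one factor is traded for raising `δ` in the other. Both the orthogonality and
the norms of the products come from this. -/
theorem mul_integral_hermiteProduct (hZ : IsComplexIsonormal Z P) (he : Orthonormal ℂ e)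
    (α β γ δ : ι →₀ ℕ) (k : ι) :
    α k * ∫ ω, hermiteProduct Z e (α - Finsupp.single k 1) β ω * hermiteProduct Z e γ δ ω ∂P =
      ∫ ω, hermiteProduct Z e α β ω * hermiteProduct Z e γ (δ + Finsupp.single k 1) ω ∂P := by
  rw [← integral_inner_mul_hermiteProduct hZ he (smoothPair_hermiteProduct Z e α β) γ δ k,
    ← integral_const_mul]
  refine integral_congr_ae (.of_forall fun ω => ?_)
  beta_reduce
  rw [inner_sum_support_smul he, mul_assoc]

theorem add_single_tsub {α : ι →₀ ℕ} {k : ι} (hk : α k ≠ 0) :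
    α - Finsupp.single k 1 + Finsupp.single k 1 = α :=
  tsub_add_cancel_of_le (Finsupp.single_le_iff.2 (Nat.one_le_iff_ne_zero.2 hk))

theorem integral_hermiteProduct_mul_eq_zero (hZ : IsComplexIsonormal Z P) (he : Orthonormal ℂ e)
    {α β γ δ : ι →₀ ℕ} (h : α ≠ δ) :
    ∫ ω, hermiteProduct Z e α β ω * hermiteProduct Z e γ δ ω ∂P = 0 := by
  obtain ⟨k, hk⟩ := Finsupp.ne_iff.1 h
  have step : ∀ α β γ δ : ι →₀ ℕ,
      δ k * ∫ ω, hermiteProduct Z e α β ω * hermiteProduct Z e γ δ ω ∂P =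
        δ k * (α k * ∫ ω, hermiteProduct Z e (α - Finsupp.single k 1) β ω *
          hermiteProduct Z e γ (δ - Finsupp.single k 1) ω ∂P) := by
    intro α β γ δ
    by_cases hδ : δ k = 0
    · simp [hδ]
    · rw [mul_integral_hermiteProduct hZ he, add_single_tsub hδ]
  have hconj : ∀ α β γ δ : ι →₀ ℕ,
      conj (∫ ω, hermiteProduct Z e α β ω * hermiteProduct Z e γ δ ω ∂P) =
        ∫ ω, hermiteProduct Z e δ γ ω * hermiteProduct Z e β α ω ∂P := by
    intro α β γ δ
    rw [← integral_conj]
    simp only [map_mul, conj_hermiteProduct, mul_comm]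
  -- Evaluating the same lowered integral from either factor gives `δ_k E = δ_k α_k E'` and, after
  -- conjugation, `α_k E = α_k δ_k E'`. Hence `(δ_k - α_k) E = 0`.
  have h1 := step α β γ δ
  have h2 := congrArg conj (step δ γ β α)
  simp only [map_mul, Complex.conj_natCast, hconj] at h2
  have h3 : ((δ k : ℂ) - α k) *
      ∫ ω, hermiteProduct Z e α β ω * hermiteProduct Z e γ δ ω ∂P = 0 := by
    rw [sub_mul, h1, h2]
    ring
  refine (mul_eq_zero.1 h3).resolve_left (sub_ne_zero.2 ?_)
  exact_mod_cast hk.symm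

/-- The random variable `∏ₖ J_{α_k,β_k}(Z(e_k), 1)` in `L²(Ω)`. -/
def hermiteLp (hZ : IsComplexIsonormal Z P) (e : ι → H) (α β : ι →₀ ℕ) : Lp ℂ 2 P :=
  (memLp_hermiteProduct hZ e α β).toLp

theorem coeFn_hermiteLp (hZ : IsComplexIsonormal Z P) (e : ι → H) (α β : ι →₀ ℕ) :
    hermiteLp hZ e α β =ᵐ[P] hermiteProduct Z e α β :=
  MemLp.coeFn_toLp _

theorem inner_hermiteLp (hZ : IsComplexIsonormal Z P) (α β γ δ : ι →₀ ℕ) :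
    ⟪hermiteLp hZ e α β, hermiteLp hZ e γ δ⟫_ℂ =
      ∫ ω, hermiteProduct Z e β α ω * hermiteProduct Z e γ δ ω ∂P := by
  rw [L2.inner_def]
  refine integral_congr_ae ?_
  filter_upwards [coeFn_hermiteLp hZ e α β, coeFn_hermiteLp hZ e γ δ] with ω h1 h2
  rw [h1, h2, RCLike.inner_apply, conj_hermiteProduct, mul_comm]

theorem inner_hermiteLp_eq_zero (hZ : IsComplexIsonormal Z P) (he : Orthonormal ℂ e)
    {α β γ δ : ι →₀ ℕ} (h : ¬(α = γ ∧ β = δ)) :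
    ⟪hermiteLp hZ e α β, hermiteLp hZ e γ δ⟫_ℂ = 0 := by
  rw [inner_hermiteLp]
  by_cases hβ : β = δ
  · have hα : γ ≠ α := fun hα => h ⟨hα.symm, hβ⟩
    rw [← integral_hermiteProduct_mul_eq_zero hZ he (β := δ) (γ := β) hα]
    simp only [mul_comm]
  · exact integral_hermiteProduct_mul_eq_zero hZ he hβ

theorem ofReal_norm_hermiteLp_sq (hZ : IsComplexIsonormal Z P) (α β : ι →₀ ℕ) :
    ((‖hermiteLp hZ e α β‖ ^ 2 : ℝ) : ℂ) =
      ∫ ω, hermiteProduct Z e β α ω * hermiteProduct Z e α β ω ∂P := by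
  rw [← inner_hermiteLp hZ, inner_self_eq_norm_sq_to_K]
  simp

theorem norm_hermiteLp_comm (hZ : IsComplexIsonormal Z P) (α β : ι →₀ ℕ) :
    ‖hermiteLp hZ e α β‖ ^ 2 = ‖hermiteLp hZ e β α‖ ^ 2 := by
  refine Complex.ofReal_injective ?_
  rw [ofReal_norm_hermiteLp_sq, ofReal_norm_hermiteLp_sq]
  simp only [mul_comm]

theorem norm_hermiteLp_add_single (hZ : IsComplexIsonormal Z P) (he : Orthonormal ℂ e)
    (α β : ι →₀ ℕ) (k : ι) : ‖hermiteLp hZ e (α + Finsupp.single k 1) β‖ ^ 2 =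
      (α k + 1) * ‖hermiteLp hZ e α β‖ ^ 2 := by
  refine Complex.ofReal_injective ?_
  rw [Complex.ofReal_mul, norm_hermiteLp_comm hZ (α + _), norm_hermiteLp_comm hZ α,
    ofReal_norm_hermiteLp_sq, ofReal_norm_hermiteLp_sq, ← mul_integral_hermiteProduct hZ he]
  simp

theorem occupation_succ {m : ℕ} (j : Fin (m + 1) → ι) :
    occupation j = occupation (Fin.tail j) + Finsupp.single (j 0) 1 := by
  rw [occupation, Fin.sum_univ_succ, add_comm]
  rfl

theorem sum_occupation {m : ℕ} (j : Fin m → ι) :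
    ∑ k ∈ (occupation j).support, occupation j k = m := by
  rw [← Finsupp.degree_apply, occupation, map_sum]
  simp

theorem occupation_le {m : ℕ} (j : Fin m → ι) (k : ι) : occupation j k ≤ m :=
  (Finsupp.le_degree k _).trans_eq ((Finsupp.degree_apply _).trans (sum_occupation j))

/-- Removing the entries of `j` one at a time costs a factor of at most the current length. -/
theorem norm_hermiteLp_occupation_le (hZ : IsComplexIsonormal Z P) (he : Orthonormal ℂ e) {m : ℕ}
    (j : Fin m → ι) (β : ι →₀ ℕ) :
    ‖hermiteLp hZ e (occupation j) β‖ ^ 2 ≤ m ! * ‖hermiteLp hZ e 0 β‖ ^ 2 := by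
  induction m with
  | zero => simp [occupation]
  | succ m ih =>
    rw [occupation_succ, norm_hermiteLp_add_single hZ he, Nat.factorial_succ, Nat.cast_mul,
      mul_assoc]
    refine mul_le_mul ?_ (ih _) (by positivity) (by positivity)
    exact_mod_cast Nat.succ_le_succ (occupation_le _ _)

theorem norm_hermiteLp_le (hZ : IsComplexIsonormal Z P) (he : Orthonormal ℂ e) {m n : ℕ}
    (j : Fin m → ι) (l : Fin n → ι) :
    ‖hermiteLp hZ e (occupation j) (occupation l)‖ ^ 2 ≤ m ! * n ! := by
  have := hZ.gaussian.isProbabilityMeasure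
  refine (norm_hermiteLp_occupation_le hZ he j _).trans ?_
  gcongr
  rw [norm_hermiteLp_comm]
  refine (norm_hermiteLp_occupation_le hZ he l _).trans_eq ?_
  have h : ((‖hermiteLp hZ e (0 : ι →₀ ℕ) 0‖ ^ 2 : ℝ) : ℂ) = 1 := by
    rw [ofReal_norm_hermiteLp_sq]
    simp [hermiteProduct]
  rw [Complex.ofReal_eq_one.1 h, mul_one]

/-- The powers of `√2` from rescaling cancel those in the normalization, and `√(α! β!)` cancels the
factorials. -/
theorem basisIntegral_eq_hermiteLp [IsProbabilityMeasure P] (hZ : IsComplexIsonormal Z P)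
    (e : ι → H) (α β : ι →₀ ℕ) :
    basisIntegral hZ e α β = hermiteLp hZ e α β := by
  classical
  rw [basisIntegral, hermiteLp, ← MemLp.toLp_const_smul]
  congr 1
  funext ω
  set K := α.support ∪ β.support with hK
  have hfac : ∀ γ : ι →₀ ℕ, γ.support ⊆ K → multiFactorial γ = ∏ k ∈ K, (γ k)! := fun γ hγ =>
    Finsupp.prod_of_support_subset γ hγ _ fun _ _ => rfl
  have hsqrt : (√(multiFactorial α * multiFactorial β : ℝ) : ℝ) =
      ∏ k ∈ K, √((α k)! * (β k)!) := by
    rw [hfac α Finset.subset_union_left, hfac β Finset.subset_union_right]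
    push_cast
    rw [← Finset.prod_mul_distrib, Real.sqrt_prod _ fun k _ => by positivity]
  rw [Pi.smul_apply, smul_eq_mul, hsqrt, fourierHermite, hermiteProduct, Complex.ofReal_prod,
    ← Finset.prod_mul_distrib]
  refine Finset.prod_congr rfl fun k _ => ?_
  rw [complexHermite_sqrt_two, mul_assoc ((2 : ℝ) ^ (α k + β k)),
    Real.sqrt_mul (by positivity) ((α k)! * (β k)! : ℝ),
    Complex.ofReal_mul]
  have h2 : √((2 : ℝ) ^ (α k + β k)) = √2 ^ (α k + β k) := by
    refine (Real.sqrt_eq_iff_mul_self_eq (by positivity) (by positivity)).2 ?_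
    rw [← mul_pow, Real.mul_self_sqrt (by norm_num)]
  rw [h2, Complex.ofReal_pow]
  have h3 : ((√2 : ℝ) : ℂ) ≠ 0 := by simp
  have h4 : ((√((α k)! * (β k)! : ℝ) : ℝ) : ℂ) ≠ 0 := by
    rw [Ne, Complex.ofReal_eq_zero, Real.sqrt_eq_zero (by positivity)]
    positivity
  field_simp

end HermiteProduct

/-! ### Convergence of the series -/

section Summability

/-- Schur's test for a family of vectors each of which is orthogonal to all but boundedly many
others. -/
theorem summable_smul_of_almost_orthogonal {X E : Type*} [NormedAddCommGroup E]
    [InnerProductSpace ℂ E] [CompleteSpace E] {τ : X → E} (r : X → X → Prop)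
    (hsymm : ∀ x y, r x y → r y x) (horth : ∀ x y, ¬r x y → ⟪τ x, τ y⟫_ℂ = 0) {M : ℝ}
    (hM : ∀ x, ‖τ x‖ ^ 2 ≤ M) {K : ℕ} (hK : ∀ x (s : Finset X), (∀ y ∈ s, r x y) → s.card ≤ K)
    {a : X → ℂ} (ha : Summable fun x => ‖a x‖ ^ 2) : Summable fun x => a x • τ x := by
  classical
  have key : ∀ s : Finset X, ‖∑ x ∈ s, a x • τ x‖ ^ 2 ≤ |M| * K * ∑ x ∈ s, ‖a x‖ ^ 2 := by
    intro s
    have h1 : ‖∑ x ∈ s, a x • τ x‖ ^ 2 ≤ ∑ x ∈ s, ∑ y ∈ s, ‖⟪a x • τ x, a y • τ y⟫_ℂ‖ := by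
      have : ((‖∑ x ∈ s, a x • τ x‖ ^ 2 : ℝ) : ℂ) =
          ∑ x ∈ s, ∑ y ∈ s, ⟪a x • τ x, a y • τ y⟫_ℂ := by
        have h := inner_self_eq_norm_sq_to_K (𝕜 := ℂ) (∑ x ∈ s, a x • τ x)
        rw [sum_inner] at h
        simp only [inner_sum] at h
        rw [h]
        simp
      calc ‖∑ x ∈ s, a x • τ x‖ ^ 2 = ‖((‖∑ x ∈ s, a x • τ x‖ ^ 2 : ℝ) : ℂ)‖ := by simp
        _ ≤ _ := by
          rw [this]
          exact (norm_sum_le _ _).trans (Finset.sum_le_sum fun x _ => norm_sum_le _ _)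
    -- By `2|a_x||a_y| ≤ |a_x|² + |a_y|²`, each double sum then has at most `K` nonzero terms per
    -- row.
    have h2 : ∀ x y, ‖⟪a x • τ x, a y • τ y⟫_ℂ‖ ≤
        |M| / 2 * ((if r x y then ‖a x‖ ^ 2 else 0) + (if r y x then ‖a y‖ ^ 2 else 0)) := by
      intro x y
      rw [inner_smul_left, inner_smul_right, norm_mul, norm_mul, RCLike.norm_conj]
      by_cases h : r x y
      · rw [if_pos h, if_pos (hsymm _ _ h)]
        have h3 : ‖⟪τ x, τ y⟫_ℂ‖ ≤ |M| := by
          refine (norm_inner_le_norm _ _).trans (le_trans ?_ (le_abs_self M))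
          nlinarith [hM x, hM y, sq_nonneg (‖τ x‖ - ‖τ y‖)]
        calc ‖a x‖ * (‖a y‖ * ‖⟪τ x, τ y⟫_ℂ‖) ≤ ‖a x‖ * (‖a y‖ * |M|) := by gcongr
          _ = |M| / 2 * (2 * ‖a x‖ * ‖a y‖) := by ring
          _ ≤ _ := by
            gcongr
            exact two_mul_le_add_sq _ _
      · rw [horth x y h, norm_zero, mul_zero, mul_zero]
        positivity
    have h3 : ∀ x, ∑ y ∈ s, (if r x y then ‖a x‖ ^ 2 else 0) ≤ K * ‖a x‖ ^ 2 := by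
      intro x
      rw [← Finset.sum_filter, Finset.sum_const, nsmul_eq_mul]
      gcongr
      exact hK x _ fun y hy => (Finset.mem_filter.1 hy).2
    calc ‖∑ x ∈ s, a x • τ x‖ ^ 2 ≤ _ := h1
      _ ≤ ∑ x ∈ s, ∑ y ∈ s, |M| / 2 *
          ((if r x y then ‖a x‖ ^ 2 else 0) + (if r y x then ‖a y‖ ^ 2 else 0)) :=
        Finset.sum_le_sum fun x _ => Finset.sum_le_sum fun y _ => h2 x y
      _ = |M| / 2 * (∑ x ∈ s, ∑ y ∈ s, (if r x y then ‖a x‖ ^ 2 else 0) +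
          ∑ x ∈ s, ∑ y ∈ s, (if r x y then ‖a x‖ ^ 2 else 0)) := by
        simp only [← Finset.mul_sum, Finset.sum_add_distrib]
        congr 2
        exact Finset.sum_comm
      _ ≤ |M| / 2 * (∑ x ∈ s, K * ‖a x‖ ^ 2 + ∑ x ∈ s, K * ‖a x‖ ^ 2) := by
        gcongr <;> exact h3 _
      _ = |M| * K * ∑ x ∈ s, ‖a x‖ ^ 2 := by
        rw [← Finset.mul_sum]
        ring
  rw [summable_iff_vanishing_norm] at ha ⊢
  intro ε hε
  obtain ⟨s, hs⟩ := ha (ε ^ 2 / (|M| * K + 1)) (by positivity)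
  refine ⟨s, fun t ht => ?_⟩
  have h1 := hs t ht
  rw [Real.norm_of_nonneg (by positivity), lt_div_iff₀ (by positivity)] at h1
  refine lt_of_pow_lt_pow_left₀ 2 hε.le ((key t).trans_lt (lt_of_le_of_lt ?_ h1))
  have : 0 ≤ ∑ x ∈ t, ‖a x‖ ^ 2 := by positivity
  nlinarith

variable {ι : Type*}

theorem exists_comp_of_occupation_eq {m : ℕ} {j j' : Fin m → ι}
    (h : occupation j = occupation j') : ∃ p : Fin m → Fin m, j' = j ∘ p := by
  classical
  have hmem : ∀ i, ∃ i', j i' = j' i := by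
    intro i
    by_contra! hne
    have h1 : occupation j (j' i) = 0 := by
      simp [occupation, Finsupp.finsetSum_apply, hne]
    rw [h, occupation, Finsupp.finsetSum_apply, Finset.sum_eq_zero_iff] at h1
    simpa using h1 i (Finset.mem_univ i)
  choose p hp using hmem
  exact ⟨p, funext fun i => (hp i).symm⟩

/-- Tuples with equal counts are reparametrizations `j ∘ p`. Arbitrary self-maps `p` in place of
permutations give a cruder bound, but any bound suffices. -/
theorem card_le_of_occupation_eq {m n : ℕ} (x : (Fin m → ι) × (Fin n → ι))
    (s : Finset ((Fin m → ι) × (Fin n → ι)))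
    (hs : ∀ y ∈ s, occupation x.1 = occupation y.1 ∧ occupation x.2 = occupation y.2) :
    s.card ≤ Fintype.card ((Fin m → Fin m) × (Fin n → Fin n)) := by
  classical
  have hsub : s ⊆ Finset.univ.image
      fun pq : (Fin m → Fin m) × (Fin n → Fin n) => (x.1 ∘ pq.1, x.2 ∘ pq.2) := by
    intro y hy
    obtain ⟨p, hp⟩ := exists_comp_of_occupation_eq (hs y hy).1
    obtain ⟨q, hq⟩ := exists_comp_of_occupation_eq (hs y hy).2
    exact Finset.mem_image.2 ⟨(p, q), Finset.mem_univ _, Prod.ext hp.symm hq.symm⟩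
  exact (Finset.card_le_card hsub).trans Finset.card_image_le

variable {Ω : Type*} [MeasurableSpace Ω] {P : Measure Ω}
  {H : Type*} [NormedAddCommGroup H] [InnerProductSpace ℂ H] {Z : H → Ω → ℂ} {e : ι → H}

theorem summable_smul_hermiteLp (hZ : IsComplexIsonormal Z P) (he : Orthonormal ℂ e) {m n : ℕ}
    {a : (Fin m → ι) × (Fin n → ι) → ℂ} (ha : Summable fun x => ‖a x‖ ^ 2) :
    Summable fun x => a x • hermiteLp hZ e (occupation x.1) (occupation x.2) := by
  refine summable_smul_of_almost_orthogonal
    (τ := fun x : (Fin m → ι) × (Fin n → ι) => hermiteLp hZ e (occupation x.1) (occupation x.2))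
    (fun x y => occupation x.1 = occupation y.1 ∧ occupation x.2 = occupation y.2)
    (fun _ _ h => ⟨h.1.symm, h.2.symm⟩) (fun _ _ h => ?_) (M := m ! * n !) (fun x => ?_)
    (K := Fintype.card ((Fin m → Fin m) × (Fin n → Fin n))) (fun x s hs => ?_) ha
  · exact inner_hermiteLp_eq_zero hZ he h
  · exact norm_hermiteLp_le hZ he x.1 x.2
  · exact card_le_of_occupation_eq x s hs

/-- Polarization: an antilinear isometry preserves the norms but reverses the sign of `i`. -/
theorem inner_conjugation {c : H ≃ₗᵢ⋆[ℂ] H} (x y : H) : ⟪c x, c y⟫_ℂ = conj ⟪x, y⟫_ℂ := by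
  have hI : ∀ v : H, Complex.I • c v = c (-(Complex.I • v)) := by
    intro v
    rw [map_neg, LinearIsometryEquiv.map_smulₛₗ]
    simp
  rw [inner_eq_sum_norm_sq_div_four, inner_eq_sum_norm_sq_div_four x y]
  simp only [RCLike.I_to_complex, hI, ← map_add, ← map_sub, LinearIsometryEquiv.norm_map]
  simp only [sub_neg_eq_add, ← sub_eq_add_neg, map_div₀, map_add, map_sub, map_mul, map_pow,
    Complex.conj_I]
  have h4 : conj (4 : ℂ) = 4 := map_ofNat _ 4
  simp only [h4, Complex.coe_algebraMap, Complex.conj_ofReal]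
  ring

theorem orthonormal_pureTensor {c : H ≃ₗᵢ⋆[ℂ] H} (he : Orthonormal ℂ e) (m n : ℕ) :
    Orthonormal ℂ fun x : (Fin m → ι) × (Fin n → ι) =>
      (pureTensor (Sum.elim (fun i => e (x.1 i)) (fun i => c (e (x.2 i)))) :
        HilbertTensor (Fin m ⊕ Fin n) H) := by
  classical
  rw [orthonormal_iff_ite] at he ⊢
  intro x y
  simp only [inner_pureTensor, Fintype.prod_sum_type, Sum.elim_inl, Sum.elim_inr,
    inner_conjugation, he, apply_ite conj, map_one, map_zero]
  rw [Finset.prod_ite_zero, Finset.prod_ite_zero]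
  simp [← ite_and, Prod.ext_iff, funext_iff, and_comm]

end Summability

/-! ### Eigenvectors -/

section Eigenvector

variable {Ω : Type*} [MeasurableSpace Ω] {P : Measure Ω}
  {H : Type*} [NormedAddCommGroup H] [InnerProductSpace ℂ H] {Z : H → Ω → ℂ} {ι : Type*} {e : ι → H}

/-- Each basis direction lowers `α_k` with factor `α_k`, and the divergence raises it back with
factor one. The eigenvalue is therefore `|α|`. -/
theorem exists_deriv_hermiteLp (hZ : IsComplexIsonormal Z P) (he : Orthonormal ℂ e)
    (α β : ι →₀ ℕ) : ∃ u : Lp H 2 P, (hermiteLp hZ e α β, u) ∈ smoothPairs Z P ∧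
      (u, ((∑ k ∈ α.support, α k : ℕ) : ℂ) • hermiteLp hZ e α β) ∈
        divergenceGraph Z P (smoothPairs Z P) := by
  have hT := smoothPair_hermiteProduct Z e α β
  have hUm := hT.memLp_deriv hZ 2 (by simp)
  obtain ⟨u, hu⟩ : ∃ u : Lp H 2 P, u =ᵐ[P] _ := ⟨hUm.toLp _, hUm.coeFn_toLp⟩
  refine ⟨u, mem_smoothPairs_iff.2 ⟨_, _, hT, coeFn_hermiteLp hZ e α β, hu⟩,
    mem_divergenceGraph_iff.2 ⟨Submodule.smul_mem _ _ ?_, fun p hp => ?_⟩⟩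
  · rw [mem_lpMeas_iff_aestronglyMeasurable]
    exact ⟨_, hT.stronglyMeasurable_sigmaAlgebra, coeFn_hermiteLp hZ e α β⟩
  obtain ⟨Φ, Ψ, hΦ, h1, h2⟩ := mem_smoothPairs_iff.1 hp
  have hL : ⟪p.1, hermiteLp hZ e α β⟫_ℂ = conj (∫ ω, Φ ω * hermiteProduct Z e β α ω ∂P) := by
    rw [L2.inner_def, ← integral_conj]
    refine integral_congr_ae ?_
    filter_upwards [h1, coeFn_hermiteLp hZ e α β] with ω h1 h2
    rw [h1, h2, RCLike.inner_apply, map_mul, conj_hermiteProduct, mul_comm]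
  rw [inner_smul_right, hL]
  have hi : ∀ k ∈ α.support, Integrable (fun ω => α k * (⟪e k, Ψ ω⟫_ℂ *
      hermiteProduct Z e β (α - Finsupp.single k 1) ω)) P := fun k _ =>
    (integrable_mul_of_memLp (hΦ.memLp_inner hZ (e k) 2 (by simp))
      (memLp_hermiteProduct hZ e β _)).const_mul _
  have hR : ∀ k ∈ α.support, ∫ ω, α k * (⟪e k, Ψ ω⟫_ℂ *
      hermiteProduct Z e β (α - Finsupp.single k 1) ω) ∂P =
        α k * ∫ ω, Φ ω * hermiteProduct Z e β α ω ∂P := by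
    intro k hk
    rw [integral_const_mul, integral_inner_mul_hermiteProduct hZ he hΦ,
      add_single_tsub (Finsupp.mem_support_iff.1 hk)]
  have := Finset.sum_congr rfl hR
  rw [← integral_finsetSum _ hi, ← Finset.sum_mul] at this
  have hconj := congrArg conj this
  rw [map_mul, ← integral_conj] at hconj
  rw [L2.inner_def]
  rw [← Nat.cast_sum, Complex.conj_natCast] at hconj
  rw [← hconj]
  refine integral_congr_ae ?_
  filter_upwards [h2, hu] with ω h2 h3
  rw [h2, h3, inner_sum, map_sum]
  refine Finset.sum_congr rfl fun k _ => ?_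
  rw [inner_smul_right, map_mul, map_mul, conj_hermiteProduct, inner_conj_symm,
    Complex.conj_natCast]
  ring

variable [CompleteSpace H]

theorem tsum_mem_ornsteinUhlenbeckGraph_iff (hZ : IsComplexIsonormal Z P) (he : Orthonormal ℂ e)
    {m n : ℕ} {a : (Fin m → ι) × (Fin n → ι) → ℂ} (ha : Summable fun x => ‖a x‖ ^ 2)
    (G : Lp ℂ 2 P) :
    (∑' x, a x • hermiteLp hZ e (occupation x.1) (occupation x.2), G) ∈
        ornsteinUhlenbeckGraph Z P ↔
      G = (m : ℂ) • ∑' x, a x • hermiteLp hZ e (occupation x.1) (occupation x.2) := by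
  choose u hu hdiv using exists_deriv_hermiteLp (e := e) hZ he
  have hmem := mem_ornsteinUhlenbeckGraph_tsum hZ (X := (Fin m → ι) × (Fin n → ι))
    (t := fun x => a x • hermiteLp hZ e (occupation x.1) (occupation x.2))
    (u := fun x => a x • u (occupation x.1) (occupation x.2)) m
    (fun x => (smoothSubmodule Z P).smul_mem (a x) (hu _ _))
    (fun x => by
      have h := (divergenceSubmodule Z P (smoothPairs Z P)).smul_mem (a x)
        (hdiv (occupation x.1) (occupation x.2))
      rw [sum_occupation, Prod.smul_mk, smul_comm] at h
      exact h)
    (summable_smul_hermiteLp hZ he ha)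
  have := hZ.gaussian.isProbabilityMeasure
  exact ⟨fun h => ornsteinUhlenbeckGraph_unique hZ h hmem, fun h => h ▸ hmem⟩

end Eigenvector

/-! ### Conjugation -/

section Conjugation

variable {Ω : Type*} [MeasurableSpace Ω] {P : Measure Ω} {H : Type*} {Z : H → Ω → ℂ}

/-- Complex conjugation on `L²(Ω)`. -/
def conjLp (P : Measure Ω) : Lp ℂ 2 P →L[ℝ] Lp ℂ 2 P :=
  Complex.conjCLE.toContinuousLinearMap.compLpL 2 P

theorem coeFn_conjLp (F : Lp ℂ 2 P) : conjLp P F =ᵐ[P] fun ω => conj (F ω) :=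
  ContinuousLinearMap.coeFn_compLpL _ F

theorem conjLp_conjLp (F : Lp ℂ 2 P) : conjLp P (conjLp P F) = F := by
  refine Lp.ext ?_
  filter_upwards [coeFn_conjLp (conjLp P F), coeFn_conjLp F] with ω h1 h2
  rw [h1, h2, Complex.conj_conj]

theorem conjLp_smul (a : ℂ) (F : Lp ℂ 2 P) : conjLp P (a • F) = conj a • conjLp P F := by
  refine Lp.ext ?_
  filter_upwards [coeFn_conjLp (a • F), coeFn_conjLp F, Lp.coeFn_smul a F,
    Lp.coeFn_smul (conj a) (conjLp P F)] with ω h1 h2 h3 h4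
  rw [h1, h4, h3, Pi.smul_apply, Pi.smul_apply, h2, smul_eq_mul, smul_eq_mul, map_mul]

theorem inner_conjLp (F G : Lp ℂ 2 P) : ⟪conjLp P F, conjLp P G⟫_ℂ = conj ⟪F, G⟫_ℂ := by
  rw [L2.inner_def, L2.inner_def, ← integral_conj]
  refine integral_congr_ae ?_
  filter_upwards [coeFn_conjLp F, coeFn_conjLp G] with ω h1 h2
  rw [h1, h2, RCLike.inner_apply, RCLike.inner_apply, map_mul]

theorem conjLp_mem_lpMeas_iff {F : Lp ℂ 2 P} :
    conjLp P F ∈ lpMeas ℂ ℂ (sigmaAlgebra Z) 2 P ↔ F ∈ lpMeas ℂ ℂ (sigmaAlgebra Z) 2 P := by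
  have h : ∀ {F : Lp ℂ 2 P}, F ∈ lpMeas ℂ ℂ (sigmaAlgebra Z) 2 P →
      conjLp P F ∈ lpMeas ℂ ℂ (sigmaAlgebra Z) 2 P := by
    intro F hF
    rw [mem_lpMeas_iff_aestronglyMeasurable] at hF ⊢
    exact (Complex.continuous_conj.comp_aestronglyMeasurable hF).congr (coeFn_conjLp F).symm
  exact ⟨fun hF => conjLp_conjLp F ▸ h hF, h⟩

variable [NormedAddCommGroup H] [InnerProductSpace ℂ H]

/-- The conjugation of `H` as a real-linear map. -/
def conjugationCLM (c : H ≃ₗᵢ⋆[ℂ] H) : H →L[ℝ] H where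
  toFun := c
  map_add' := map_add c
  map_smul' r x := by
    have := LinearIsometryEquiv.map_smulₛₗ c (r : ℂ) x
    simpa using this
  cont := c.continuous

/-- The pointwise conjugation on `L²(Ω; H)`. -/
def conjugationLp (P : Measure Ω) (c : H ≃ₗᵢ⋆[ℂ] H) : Lp H 2 P →L[ℝ] Lp H 2 P :=
  (conjugationCLM c).compLpL 2 P

theorem coeFn_conjugationLp (c : H ≃ₗᵢ⋆[ℂ] H) (u : Lp H 2 P) :
    conjugationLp P c u =ᵐ[P] fun ω => c (u ω) :=
  ContinuousLinearMap.coeFn_compLpL _ u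

theorem conjugationLp_conjugationLp {c : H ≃ₗᵢ⋆[ℂ] H} (hc : ∀ h, c (c h) = h) (u : Lp H 2 P) :
    conjugationLp P c (conjugationLp P c u) = u := by
  refine Lp.ext ?_
  filter_upwards [coeFn_conjugationLp c (conjugationLp P c u), coeFn_conjugationLp c u]
    with ω h1 h2
  rw [h1, h2, hc]

theorem inner_conjugationLp (c : H ≃ₗᵢ⋆[ℂ] H) (u v : Lp H 2 P) :
    ⟪conjugationLp P c u, conjugationLp P c v⟫_ℂ = conj ⟪u, v⟫_ℂ := by
  rw [L2.inner_def, L2.inner_def, ← integral_conj]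
  refine integral_congr_ae ?_
  filter_upwards [coeFn_conjugationLp c u, coeFn_conjugationLp c v] with ω h1 h2
  rw [h1, h2, inner_conjugation]

theorem conjLp_hermiteLp (hZ : IsComplexIsonormal Z P) {ι : Type*} (e : ι → H) (α β : ι →₀ ℕ) :
    conjLp P (hermiteLp hZ e α β) = hermiteLp hZ e β α := by
  refine Lp.ext ?_
  filter_upwards [coeFn_conjLp (hermiteLp hZ e α β), coeFn_hermiteLp hZ e α β,
    coeFn_hermiteLp hZ e β α] with ω h1 h2 h3
  rw [h1, h2, h3, conj_hermiteProduct]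

/-- Conjugation of pairs of a random variable and its derivative. -/
def conjPair (P : Measure Ω) {c : H ≃ₗᵢ⋆[ℂ] H} (hc : ∀ h, c (c h) = h) :
    (Lp ℂ 2 P × Lp H 2 P) ≃ₜ (Lp ℂ 2 P × Lp H 2 P) where
  toFun p := (conjLp P p.1, conjugationLp P c p.2)
  invFun p := (conjLp P p.1, conjugationLp P c p.2)
  left_inv p := by beta_reduce; rw [conjLp_conjLp, conjugationLp_conjugationLp hc]
  right_inv p := by beta_reduce; rw [conjLp_conjLp, conjugationLp_conjugationLp hc]
  continuous_toFun := by fun_prop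
  continuous_invFun := by fun_prop

theorem conjPair_apply {c : H ≃ₗᵢ⋆[ℂ] H} (hc : ∀ h, c (c h) = h) (p : Lp ℂ 2 P × Lp H 2 P) :
    conjPair P hc p = (conjLp P p.1, conjugationLp P c p.2) := rfl

theorem conjPair_conjPair {c : H ≃ₗᵢ⋆[ℂ] H} (hc : ∀ h, c (c h) = h) (p : Lp ℂ 2 P × Lp H 2 P) :
    conjPair P hc (conjPair P hc p) = p :=
  (conjPair P hc).left_inv p

/-- This is `D̄F = conj (D (conj F))`, from which all statements about the barred operators are
transported. -/
theorem conjPair_mem_smoothPairs_iff {c : H ≃ₗᵢ⋆[ℂ] H} (hc : ∀ h, c (c h) = h)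
    {p : Lp ℂ 2 P × Lp H 2 P} : conjPair P hc p ∈ smoothPairs Z P ↔ p ∈ smoothPairsBar Z P c := by
  have hsum : ∀ {k : ℕ} (a : Fin k → ℂ) (v : Fin k → H),
      c (∑ j, a j • v j) = ∑ j, conj (a j) • c (v j) := by
    intro k a v
    rw [map_sum]
    exact Finset.sum_congr rfl fun j _ => LinearIsometryEquiv.map_smulₛₗ c _ _
  constructor
  · rintro ⟨k, v, f, hf, h1, h2⟩
    refine ⟨k, v, fun z => conj (f z), hasTemperateGrowth_conj hf, ?_, ?_⟩
    · filter_upwards [h1, coeFn_conjLp p.1] with ω h1 h2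
      rw [← h1, conjPair_apply, h2, Complex.conj_conj]
    · filter_upwards [h2, coeFn_conjugationLp c p.2] with ω h1 h2
      rw [conjPair_apply, h2] at h1
      rw [← hc (p.2 ω), h1, hsum]
      refine Finset.sum_congr rfl fun j _ => ?_
      rw [wirtingerBar_eq_conj j ((hasTemperateGrowth_conj hf).1.differentiable (by simp))]
      simp only [Complex.conj_conj]
  · rintro ⟨k, v, f, hf, h1, h2⟩
    refine ⟨k, v, fun z => conj (f z), hasTemperateGrowth_conj hf, ?_, ?_⟩
    · filter_upwards [h1, coeFn_conjLp p.1] with ω h1 h2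
      rw [conjPair_apply, h2, h1]
    · filter_upwards [h2, coeFn_conjugationLp c p.2] with ω h1 h2
      rw [conjPair_apply, h2, h1, hsum]
      refine Finset.sum_congr rfl fun j _ => ?_
      rw [wirtingerBar_eq_conj j (hf.1.differentiable (by simp)), Complex.conj_conj, hc]

theorem conjPair_mem_malliavinGraph_iff {c : H ≃ₗᵢ⋆[ℂ] H} (hc : ∀ h, c (c h) = h)
    {p : Lp ℂ 2 P × Lp H 2 P} :
    conjPair P hc p ∈ malliavinGraph Z P ↔ p ∈ malliavinGraphBar Z P c := by
  have h : smoothPairsBar Z P c = conjPair P hc ⁻¹' smoothPairs Z P :=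
    Set.ext fun p => (conjPair_mem_smoothPairs_iff hc).symm
  rw [malliavinGraphBar, malliavinGraph, h, ← Homeomorph.preimage_closure]
  rfl

theorem conj_mem_divergenceGraph_iff {c : H ≃ₗᵢ⋆[ℂ] H} (hc : ∀ h, c (c h) = h)
    {u : Lp H 2 P} {G : Lp ℂ 2 P} :
    (conjugationLp P c u, conjLp P G) ∈ divergenceGraph Z P (smoothPairs Z P) ↔
      (u, G) ∈ divergenceGraph Z P (smoothPairsBar Z P c) := by
  rw [mem_divergenceGraph_iff, mem_divergenceGraph_iff, conjLp_mem_lpMeas_iff]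
  refine and_congr_right fun _ => ⟨fun h p hp => ?_, fun h p hp => ?_⟩
  · have := h _ ((conjPair_mem_smoothPairs_iff hc).2 hp)
    rw [conjPair_apply, inner_conjLp, inner_conjugationLp] at this
    exact (starRingEnd ℂ).injective this
  · have h1 := h (conjPair P hc p) ((conjPair_mem_smoothPairs_iff hc).1
      (by rwa [conjPair_conjPair hc]))
    have := congrArg conj h1
    rwa [conjPair_apply, ← inner_conjLp, ← inner_conjugationLp, conjLp_conjLp,
      conjugationLp_conjugationLp hc] at this

theorem conj_mem_ornsteinUhlenbeckGraph_iff {c : H ≃ₗᵢ⋆[ℂ] H} (hc : ∀ h, c (c h) = h)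
    {F G : Lp ℂ 2 P} : (conjLp P F, conjLp P G) ∈ ornsteinUhlenbeckGraph Z P ↔
      (F, G) ∈ ornsteinUhlenbeckGraphBar Z P c := by
  constructor
  · rintro ⟨u, h1, h2⟩
    rw [← conjugationLp_conjugationLp hc u] at h1 h2
    exact ⟨conjugationLp P c u, (conjPair_mem_malliavinGraph_iff hc).1 h1,
      (conj_mem_divergenceGraph_iff hc).1 h2⟩
  · rintro ⟨u, h1, h2⟩
    exact ⟨conjugationLp P c u, (conjPair_mem_malliavinGraph_iff hc).2 h1,
      (conj_mem_divergenceGraph_iff hc).2 h2⟩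

end Conjugation

end

end ComplexWiener

/-! ### The eigenvalue equations for multiple integrals. -/

theorem mainTheorem5 {Ω : Type*} [MeasurableSpace Ω] (P : MeasureTheory.Measure Ω)
    [MeasureTheory.IsProbabilityMeasure P]
    {H : Type*} [NormedAddCommGroup H] [InnerProductSpace ℂ H] [CompleteSpace H]
    [TopologicalSpace.SeparableSpace H]
    (c : H ≃ₗᵢ⋆[ℂ] H) (hc : ∀ h, c (c h) = h)
    (Z : H → Ω → ℂ) (hZ : ComplexWiener.IsComplexIsonormal Z P)
    {ι : Type*} (e : HilbertBasis ι ℂ H) (m n : ℕ)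
    (f : ComplexWiener.HilbertTensor (Fin m ⊕ Fin n) H)
    (hf : f ∈ ComplexWiener.symmetricTensors H m n) :
    Summable (ComplexWiener.integralTerm hZ c e f) ∧
    (∀ G : MeasureTheory.Lp ℂ 2 P,
      (ComplexWiener.multipleIntegral hZ c e f, G) ∈ ComplexWiener.ornsteinUhlenbeckGraph Z P ↔
        G = (m : ℂ) • ComplexWiener.multipleIntegral hZ c e f) ∧
    (∀ G : MeasureTheory.Lp ℂ 2 P,
      (ComplexWiener.multipleIntegral hZ c e f, G) ∈ ComplexWiener.ornsteinUhlenbeckGraphBar Z P c ↔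
        G = (n : ℂ) • ComplexWiener.multipleIntegral hZ c e f) := by
  open ComplexWiener in
  have he := e.orthonormal
  let a : (Fin m → ι) × (Fin n → ι) → ℂ := fun x =>
    inner ℂ (pureTensor (Sum.elim (fun i => e (x.1 i)) (fun i => c (e (x.2 i))))) f
  have hterm : ComplexWiener.integralTerm hZ c e f =
      fun x => a x • hermiteLp hZ e (occupation x.1) (occupation x.2) := by
    funext x
    rw [integralTerm, basisIntegral_eq_hermiteLp]
  have ha : Summable fun x => ‖a x‖ ^ 2 :=
    (orthonormal_pureTensor (c := c) he m n).inner_products_summable f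
  have hsum := summable_smul_hermiteLp hZ he ha
  have hI : multipleIntegral hZ c e f =
      ∑' x, a x • hermiteLp hZ e (occupation x.1) (occupation x.2) := by
    rw [multipleIntegral, hterm]
  refine ⟨hterm ▸ hsum, fun G => hI ▸ tsum_mem_ornsteinUhlenbeckGraph_iff hZ he ha G, fun G => ?_⟩
  -- Conjugating the series swaps the two multi-indices, so the conjugate is a series of type `(n,
  -- m)`, on which `L` has eigenvalue `n`.
  let a' : (Fin n → ι) × (Fin m → ι) → ℂ := fun x => conj (a x.swap)
  have ha' : Summable fun x => ‖a' x‖ ^ 2 := by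
    simp only [a', RCLike.norm_conj]
    exact (Equiv.prodComm _ _).summable_iff.2 ha
  have hconj : conjLp P (multipleIntegral hZ c e f) =
      ∑' x, a' x • hermiteLp hZ e (occupation x.1) (occupation x.2) := by
    rw [hI, (conjLp P).map_tsum hsum, ← (Equiv.prodComm _ _).tsum_eq]
    refine tsum_congr fun x => ?_
    rw [conjLp_smul, conjLp_hermiteLp]
    rfl
  rw [← conj_mem_ornsteinUhlenbeckGraph_iff hc, hconj,
    tsum_mem_ornsteinUhlenbeckGraph_iff hZ he ha', ← hconj]
  constructor
  · intro h
    have := congrArg (conjLp P) h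
    rwa [conjLp_smul, conjLp_conjLp, conjLp_conjLp, Complex.conj_natCast] at this
  · rintro rfl
    rw [conjLp_smul, Complex.conj_natCast]
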